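/- **Weak irreducibility.** Let $\mathbb T^2=[-\pi,\pi]^2$ be the torus with Lebesgue measure, let $H=\{w\in L^2(\mathbb T^2,\mathbb R):\int w\,dx=0\}$ with the $L^2$ norm $\|\cdot\|$, and for $a>0$ let $H_a=\{w\in H:\|w\|_a<\infty\}$, $\|w\|_a=\|(-\Delta)^{a/2}w\|$, $H_\infty=\bigcap_{a>0}H_a$. Let $\nu>0$, $\mathcal T>0$, $d\in\mathbb N$, $g_1,\dots,g_d\in H_\infty$, and let $f\in C(\mathbb R,H_1)\cap L^2_{\mathrm{loc}}(\mathbb R,H_2)$ be $\mathcal T$-periodic. Consider the two-dimensional stochastic Navier–Stokes equation in vorticity form $$dw+B(\mathcal Kw,w)\,dt=\nu\Delta w\,dt+f\,dt+\sum_{i=1}^d g_i\,dW_i(t),\quad t>s,\qquad w(s)=w_0\in H,$$ where $\mathcal K$ is the Biot–Savart operator, $B(\mathcal Ku,v)=(\mathcal Ku)\cdot\nabla v$, and $W$ is a two-sided standard $d$-dimensional Brownian motion. Solutions are adapted to $W$ (up to null sets), have almost surely paths in $C([s,\infty);H)\cap C((s,\infty);H_3)$, and satisfy the equation tested against every element of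 $H_\infty$. Let $\mathcal P^*_{s,t}\delta_{w_0}$ denote the law on $H$, at time $t\ge s$, of the solution started from $w_0$ at time $s$. Let $c_0$ be a constant such that Ladyzhenskaya's inequality $\|w\|_{L^4(\mathbb T^2)}^2\le c_0\|w\|_1\|w\|$ holds for all $w\in H_1$, and let $G_1=\nu^{-2}\sup_{t\in\mathbb R}\|f(t)\|$. For $\eta>0$ and $r\in(0,1]$ let $$\rho_r(w_1,w_2)=\inf_\gamma\int_0^1 e^{r\eta\|\gamma(t)\|^2}\,\|\dot\gamma(t)\|\,dt,$$ the infimum being over all differentiable paths $\gamma:[0,1]\to H$ from $w_1$ to $w_2$. Assume $G_1<1/c_0$ and let $\eta>0$. Then for all $R,\varepsilon>0$ and $r\in(0,1]$ there is $n_0\in\mathbb N$ such that for every integer $n\ge n_0$ there is $a>0$ with the following property: for all $s\in\mathbb R$ and all $w_1,w_2\in H$ with $\|w_1\|,\|w_2\|\le R$ there is a coupling $\Gamma$ of $\mathcal P^*_{s,s+n\mathcal T}\delta_{w_1}$ and $\mathcal P^*_{s,s+n\mathcal T}\delta_{w_2}$ such that $$\Gamma\{(w_1',w_2')\in H\times H:\rho_r(w_1',w_2')<\varepsilon\}\ge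 a.$$ -/

import Mathlib

open MeasureTheory ProbabilityTheory Filter Topology Set
open scoped ENNReal NNReal

namespace StochasticNS

noncomputable section

/-! ### The torus, the state space and Fourier series -/

instance factTwoPiPos : Fact (0 < 2 * Real.pi) := ⟨Real.two_pi_pos⟩

/-- The torus `[-π, π]²`, i.e. `(ℝ / 2πℤ)²`, with its Lebesgue measure, of total mass `4π²`. -/
abbrev Torus : Type := Fin 2 → AddCircle (2 * Real.pi)

/-- The square integrable real functions on the torus with mean zero. -/
def meanZero : Submodule ℝ (Lp ℝ 2 (volume : Measure Torus)) where
  carrier := {w | ∫ x, w x = 0}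
  zero_mem' := by
    have h : ∫ x, (0 : Lp ℝ 2 (volume : Measure Torus)) x = ∫ _ : Torus, (0 : ℝ) :=
      integral_congr_ae (Lp.coeFn_zero ℝ 2 volume)
    exact h.trans (by simp)
  add_mem' := by
    intro u v hu hv
    have hi (w : Lp ℝ 2 (volume : Measure Torus)) : Integrable w volume :=
      (Lp.memLp w).integrable (by norm_num)
    have h : ∫ x, (u + v) x = ∫ x, (u x + v x) := integral_congr_ae (Lp.coeFn_add u v)
    simp only [mem_ofPred_eq] at hu hv ⊢
    rw [h, integral_add (hi u) (hi v), hu, hv, add_zero]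
  smul_mem' := by
    intro c u hu
    have h : ∫ x, (c • u) x = ∫ x, c * u x := integral_congr_ae (Lp.coeFn_smul c u)
    simp only [mem_ofPred_eq] at hu ⊢
    rw [h, integral_const_mul, hu, mul_zero]

/-- The state space `H`, a closed subspace of `L²`, with the norm and inner product of `L²`. -/
abbrev H : Type := meanZero

instance measurableSpaceH : MeasurableSpace H := borel H

instance borelSpaceH : BorelSpace H := ⟨rfl⟩

/-- The character `x ↦ exp (i k·x)`. -/
def character (k : Fin 2 → ℤ) : C(Torus, ℂ) where
  toFun x := fourier (k 0) (x 0) * fourier (k 1) (x 1)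
  continuous_toFun := by fun_prop

/-- The Fourier coefficient `(2π)⁻² ∫ w(x) exp (-i k·x) dx`. -/
def coeff (w : H) (k : Fin 2 → ℤ) : ℂ :=
  (4 * (Real.pi : ℂ) ^ 2)⁻¹ * ∫ x : Torus, character (-k) x * ((w : Lp ℝ 2 volume) x : ℂ)

/-- `|k|²`. -/
def normSq (k : Fin 2 → ℤ) : ℝ := (k 0 : ℝ) ^ 2 + (k 1 : ℝ) ^ 2

/-- The norm `‖w‖_a = ‖(-Δ)^(a/2) w‖` of the space `H_a`; the value `∞` means `w ∉ H_a`. -/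
def sobolevNorm (a : ℝ) (w : H) : ℝ≥0∞ :=
  (∑' k : Fin 2 → ℤ, ENNReal.ofReal (4 * Real.pi ^ 2 * normSq k ^ a * ‖coeff w k‖ ^ 2))
    ^ (1 / 2 : ℝ)

/-- Membership in `H_∞ = ⋂_{a > 0} H_a`. -/
def IsSmooth (w : H) : Prop := ∀ a : ℝ, 0 < a → sobolevNorm a w < ∞

/-- Continuity on `S` of a path in `H_a`. -/
def SobolevContinuousOn (a : ℝ) (u : ℝ → H) (S : Set ℝ) : Prop :=
  ∀ t ∈ S, sobolevNorm a (u t) < ∞ ∧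
    Tendsto (fun r => sobolevNorm a (u r - u t)) (𝓝[S] t) (𝓝 0)

/-- The Fourier multiplier with symbol `m`: the function with Fourier series
`∑ m(k) ŵ(k) exp (i k·x)`, the sum being taken in `L²`. (For the symbols used below this is a
real function, so that taking the real part changes nothing.) -/
def multiplier (m : (Fin 2 → ℤ) → ℂ) (w : H) (x : Torus) : ℝ :=
  ((∑' k : Fin 2 → ℤ, (m k * coeff w k) • ContinuousMap.toLp 2 volume ℂ (character k) :
    Lp ℂ 2 (volume : Measure Torus)) x).re

/-- The partial derivative `∂_j w`. -/
def partialDeriv (j : Fin 2) (w : H) : Torus → ℝ :=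
  multiplier (fun k => Complex.I * (k j : ℂ)) w

/-- The Laplacian `Δ w`. -/
def laplacian (w : H) : Torus → ℝ :=
  multiplier (fun k => -(normSq k : ℂ)) w

/-- The Biot-Savart operator: `𝒦 w = (-∂₂ Δ⁻¹ w, ∂₁ Δ⁻¹ w)`, the divergence free velocity field of
mean zero with vorticity `w`. -/
def velocity (w : H) (j : Fin 2) : Torus → ℝ :=
  multiplier (fun k => (![Complex.I * (k 1 : ℂ), -(Complex.I * (k 0 : ℂ))] j) / (normSq k : ℂ)) w

/-- The nonlinear term `B(𝒦 u, v) = (𝒦 u)·∇v`. -/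
def advection (u v : H) (x : Torus) : ℝ := ∑ j, velocity u j x * partialDeriv j v x

/-! ### The noise and the equation -/

section Probability

variable {Ω : Type} [MeasurableSpace Ω] {d : ℕ}

/-- Two-sided standard `d`-dimensional Brownian motion: the coordinates of `t ↦ W t` and
`t ↦ W (-t)`, `t ≥ 0`, are `2d` independent standard Brownian motions. -/
structure IsTwoSidedBrownian (W : ℝ → Ω → Fin d → ℝ) (P : Measure Ω) : Prop where
  measurable : ∀ t, Measurable (W t)
  forward : ∀ i, IsBrownianReal (fun (t : ℝ≥0) ω => W t ω i) P
  backward : ∀ i, IsBrownianReal (fun (t : ℝ≥0) ω => W (-(t : ℝ)) ω i) P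
  indep : iIndepFun (fun (p : Fin d × Bool) ω (t : ℝ≥0) =>
    W (if p.2 then (t : ℝ) else -(t : ℝ)) ω p.1) P

/-- The `σ`-algebra generated by `W u`, `u ≤ t`. -/
abbrev noiseHistory (W : ℝ → Ω → Fin d → ℝ) (t : ℝ) : MeasurableSpace Ω :=
  ⨆ u ∈ Iic t, MeasurableSpace.comap (W u) inferInstance

/-- `w` is the solution, started from `w₀` at time `s`, of
`dw + B(𝒦w, w) dt = ν Δw dt + f dt + G dW`, where `G eᵢ = gᵢ`.
Adaptedness is understood up to null sets. Almost surely the paths lie in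
`C([s, ∞); H) ∩ C((s, ∞); H₃)` and satisfy the equation tested against every element of `H_∞`. -/
structure IsSolution (ν : ℝ) (f : ℝ → H) (g : Fin d → H) (P : Measure Ω)
    (W : ℝ → Ω → Fin d → ℝ) (s : ℝ) (w₀ : H) (w : ℝ → Ω → H) : Prop where
  adapted : ∀ t, s ≤ t → AEStronglyMeasurable[noiseHistory W t] (w t) P
  initial : ∀ᵐ ω ∂P, w s ω = w₀
  continuous : ∀ᵐ ω ∂P, ContinuousOn (fun t => w t ω) (Ici s)
  regular : ∀ᵐ ω ∂P, SobolevContinuousOn 3 (fun t => w t ω) (Ioi s)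
  equation : ∀ᵐ ω ∂P, ∀ φ : H, IsSmooth φ → ∀ t, s ≤ t →
    inner ℝ (w t ω) φ = inner ℝ w₀ φ
      + (∫ u in s..t, (ν * (∫ x, (w u ω : Lp ℝ 2 volume) x * laplacian φ x)
          - (∫ x, advection (w u ω) (w u ω) x * (φ : Lp ℝ 2 volume) x)
          + inner ℝ (f u) φ))
      + ∑ i, inner ℝ (g i) φ * (W t ω i - W s ω i)

end Probability

/-- `μ` is the transition probability `𝒫*_{s,t} δ_{w₀} = 𝒫_{s,t}(w₀, ·)`: the law at time `t` of the
solution started from `w₀` at time `s`. -/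
def IsTransitionProbability (ν : ℝ) (f : ℝ → H) {d : ℕ} (g : Fin d → H) (s t : ℝ) (w₀ : H)
    (μ : Measure H) : Prop :=
  ∃ (Ω : Type) (_ : MeasurableSpace Ω) (P : Measure Ω) (W : ℝ → Ω → Fin d → ℝ) (w : ℝ → Ω → H),
    IsProbabilityMeasure P ∧ IsTwoSidedBrownian W P ∧ IsSolution ν f g P W s w₀ w ∧
      μ = P.map (w t)

/-! ### Constants, the weighted metric and couplings -/

/-- `c₀` is a constant for Ladyzhenskaya's inequality `‖w‖_{L⁴}² ≤ c₀ ‖w‖₁ ‖w‖` on `H₁`. -/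
def IsLadyzhenskayaConst (c₀ : ℝ) : Prop :=
  ∀ w : H, sobolevNorm 1 w < ∞ →
    eLpNorm (w : Lp ℝ 2 (volume : Measure Torus)) 4 volume ^ 2
      ≤ ENNReal.ofReal c₀ * sobolevNorm 1 w * ENNReal.ofReal ‖w‖

/-- The Grashof number `G₁ = ‖f‖_∞ / ν²`, `‖f‖_∞ = sup_t ‖f(t)‖`. -/
def grashof (ν : ℝ) (f : ℝ → H) : ℝ := (⨆ t, ‖f t‖) / ν ^ 2

/-- The Lyapunov function `V(w) = exp (η ‖w‖²)`. -/
def lyapunov (η : ℝ) (w : H) : ℝ := Real.exp (η * ‖w‖ ^ 2)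

/-- The metric `ρ_r(w₁, w₂) = inf_γ ∫₀¹ V^r(γ(t)) ‖γ'(t)‖ dt`, the infimum being over the
differentiable paths `γ : [0, 1] → H` from `w₁` to `w₂`. -/
def weightedDist (η r : ℝ) (w₁ w₂ : H) : ℝ≥0∞ :=
  ⨅ (γ : ℝ → H) (_ : DifferentiableOn ℝ γ (Icc 0 1) ∧ γ 0 = w₁ ∧ γ 1 = w₂),
    ∫⁻ t in Icc (0 : ℝ) 1,
      ENNReal.ofReal (lyapunov η (γ t) ^ r * ‖derivWithin γ (Icc 0 1) t‖)

/-- `Γ` is a coupling of `μ₁` and `μ₂`. -/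
def IsCoupling (Γ : Measure (H × H)) (μ₁ μ₂ : Measure H) : Prop :=
  Γ.map Prod.fst = μ₁ ∧ Γ.map Prod.snd = μ₂

end

end StochasticNS

/-!
The coupling is the product coupling. It therefore suffices that the laws at time `s + n𝒯` of the
two solutions charge, with a probability bounded below uniformly in `s` and the initial conditions,
two sets such that each point of the first is `ε`-close for `ρ_r` to each point of the second.

On the event that the increments of the Brownian motion stay below `δ` on `[s, s + n𝒯]`, which has a
probability bounded below by a constant depending on `δ`, `n𝒯` and `d` only (`exists_small_noise`),
the noise `ζ(t) = ∑ gᵢ (Wᵢ(t) - Wᵢ(s))` is small in `H₃`, and `v = w - ζ` is a classical solution of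
`v' = νΔ(v + ζ) - B(𝒦(v + ζ), v + ζ) + f` (`isPerturbedSolution_sub_noise`).

Two such perturbed solutions approach each other (`exists_contraction`). Without perturbation, the
difference `z = v₁ - v₂` satisfies, by Ladyzhenskaya's inequality,
`d/dt ‖z‖² ≤ (-ν + c₀² ν⁻¹ ‖v₁‖₁²) ‖z‖²`, while the energy inequality is
`d/dt ‖v₁‖² ≤ -ν ‖v₁‖₁² + ‖f‖² / ν`. The functional `‖z‖² exp (β ‖v₁‖²)` with `β = c₀² / ν²`
therefore decays at the rate `ν - c₀² ‖f‖_∞² / ν³`, which is positive when `G₁ < 1 / c₀`. For the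
perturbed solutions the constants move a little and `‖z‖²` is replaced by `‖z‖² + θ` with a small
`θ > 0`, which absorbs the errors of order `δ (1 + ‖v₁‖₁²)`. Finally `ρ_r` is bounded by the
weighted
length of the straight segment (`weightedDist_le`).

Regularity is handled in coordinates: an element of `H₃` is written `smoothing h` with `h ∈ H` and
`smoothing = (-Δ)^(-3/2)`. The operators of the equation become bounded linear and bilinear
operators of `h` (`laplacianOp`, `velocityOp`, `advectionOp`), defined by Fourier multipliers, and
the path `h` is continuous in `H` exactly when `w` is continuous in `H₃`.
-/

namespace StochasticNS

open scoped ComplexConjugate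

/-! ### Characters -/

lemma character_apply (k : Fin 2 → ℤ) (x : Torus) :
    character k x = fourier (k 0) (x 0) * fourier (k 1) (x 1) := rfl

lemma character_neg (k : Fin 2 → ℤ) (x : Torus) : character (-k) x = conj (character k x) := by
  simp [character_apply]

lemma character_mul (k l : Fin 2 → ℤ) : character k * character l = character (k + l) := by
  ext x
  simp only [ContinuousMap.mul_apply, character_apply, Pi.add_apply, fourier_add]
  ring

lemma character_zero : character 0 = 1 := by
  ext x
  simp [character_apply]

lemma norm_character_apply (k : Fin 2 → ℤ) (x : Torus) : ‖character k x‖ = 1 := by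
  have h (n : ℤ) (y : AddCircle (2 * Real.pi)) : ‖fourier n y‖ = 1 := Circle.norm_coe _
  rw [character_apply, norm_mul, h, h, one_mul]

lemma norm_character_le (k : Fin 2 → ℤ) : ‖character k‖ ≤ 1 :=
  (ContinuousMap.norm_le _ zero_le_one).mpr fun x => (norm_character_apply k x).le

lemma integral_fourier (n : ℤ) :
    ∫ x : AddCircle (2 * Real.pi), fourier n x = if n = 0 then (2 * Real.pi : ℂ) else 0 := by
  have h := congrFun (fourierCoeff_fourier (T := 2 * Real.pi) n) 0
  have hpi : (2 * Real.pi : ℂ) ≠ 0 := by exact_mod_cast Real.two_pi_pos.ne'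
  simp only [fourierCoeff, neg_zero, fourier_zero, one_smul] at h
  rw [AddCircle.integral_haarAddCircle, inv_smul_eq_iff₀ Real.two_pi_pos.ne'] at h
  rw [h, Pi.single_apply]
  rcases eq_or_ne n 0 with hn | hn
  · simp [hn]
  · simp [hn, hn.symm]

lemma integral_character (k : Fin 2 → ℤ) :
    ∫ x : Torus, character k x = if k = 0 then (4 * Real.pi ^ 2 : ℂ) else 0 := by
  have h : ∫ x : Torus, character k x = ∏ i, ∫ x : AddCircle (2 * Real.pi), fourier (k i) x := by
    rw [← MeasureTheory.integral_fintype_prod_volume_eq_prod]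
    simp [character_apply, Fin.prod_univ_two]
  rw [h, Fin.prod_univ_two, integral_fourier, integral_fourier]
  have : k = 0 ↔ k 0 = 0 ∧ k 1 = 0 := by
    rw [funext_iff, Fin.forall_fin_two]; rfl
  simp only [this]
  split_ifs with h1 h2 h3 <;> first | tauto | skip
  · ring
  all_goals simp

/-! ### Completeness of the characters -/

/-- The star subalgebra of `C(Torus, ℂ)` generated by the characters. -/
noncomputable def characterSubalgebra : StarSubalgebra ℂ C(Torus, ℂ) where
  toSubalgebra := Algebra.adjoin ℂ (range character)
  star_mem' := by
    change Algebra.adjoin ℂ (range character) ≤ star (Algebra.adjoin ℂ (range character))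
    refine Algebra.adjoin_le ?_
    rintro _ ⟨n, rfl⟩
    refine Algebra.subset_adjoin ⟨-n, ?_⟩
    ext1 x
    simp only [character_neg, starRingEnd_apply, ContinuousMap.star_apply]

lemma characterSubalgebra_coe :
    characterSubalgebra.toSubalgebra.toSubmodule = Submodule.span ℂ (range character) := by
  apply Algebra.adjoin_eq_span_of_subset
  refine .trans (fun x ↦ Submonoid.closure_induction (fun _ ↦ id) ⟨0, character_zero⟩ ?_)
    Submodule.subset_span
  rintro _ _ _ _ ⟨m, rfl⟩ ⟨n, rfl⟩
  exact ⟨m + n, (character_mul m n).symm⟩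

lemma characterSubalgebra_separatesPoints : characterSubalgebra.SeparatesPoints := by
  intro x y hxy
  rw [Ne, funext_iff, not_forall] at hxy
  obtain ⟨i, hi⟩ := hxy
  refine ⟨_, ⟨character (Pi.single i 1), Algebra.subset_adjoin ⟨Pi.single i 1, rfl⟩, rfl⟩, ?_⟩
  dsimp only
  have key (z : Torus) : character (Pi.single i 1) z = fourier 1 (z i) := by
    rw [character_apply]
    fin_cases i <;> simp
  rw [key, key, fourier_one, fourier_one]
  exact fun h => hi (AddCircle.injective_toCircle Real.two_pi_pos.ne' (Circle.ext h))

lemma span_character_closure_eq_top :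
    (Submodule.span ℂ (range character)).topologicalClosure = ⊤ := by
  rw [← characterSubalgebra_coe]
  exact congr_arg (Subalgebra.toSubmodule <| StarSubalgebra.toSubalgebra ·)
    (ContinuousMap.starSubalgebra_topologicalClosure_eq_top_of_separatesPoints _
      characterSubalgebra_separatesPoints)

/-- The character `exp (i k·x)` as an element of the complex space `L²`. -/
noncomputable abbrev characterLp (k : Fin 2 → ℤ) : Lp ℂ 2 (volume : Measure Torus) :=
  ContinuousMap.toLp 2 volume ℂ (character k)

lemma inner_characterLp (k : Fin 2 → ℤ) (G : Lp ℂ 2 (volume : Measure Torus)) :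
    inner ℂ (characterLp k) G = ∫ x, character (-k) x * G x := by
  rw [L2.inner_def]
  refine integral_congr_ae ?_
  filter_upwards [ContinuousMap.coeFn_toLp (𝕜 := ℂ) (p := 2) volume (character k)] with x hx
  rw [hx, RCLike.inner_apply, character_neg, mul_comm]

lemma inner_characterLp_characterLp (k l : Fin 2 → ℤ) :
    inner ℂ (characterLp k) (characterLp l) = if k = l then (4 * Real.pi ^ 2 : ℂ) else 0 := by
  rw [ContinuousMap.inner_toLp]
  simp_rw [← character_neg, mul_comm (character l _), ← ContinuousMap.mul_apply, character_mul]
  rw [integral_character]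
  simp [neg_add_eq_zero]

/-- The orthonormal family `(2π)⁻¹ exp (i k·x)`. -/
noncomputable def normalizedCharacter (k : Fin 2 → ℤ) : Lp ℂ 2 (volume : Measure Torus) :=
  ((2 * Real.pi : ℂ)⁻¹) • characterLp k

lemma orthonormal_normalizedCharacter : Orthonormal ℂ normalizedCharacter := by
  have hpi : (Real.pi : ℂ) ≠ 0 := by exact_mod_cast Real.pi_ne_zero
  rw [orthonormal_iff_ite]
  intro k l
  simp only [normalizedCharacter, inner_smul_left, inner_smul_right,
    inner_characterLp_characterLp]
  split_ifs
  · simp only [map_inv₀, map_mul, Complex.conj_ofReal, map_ofNat]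
    field_simp
    norm_num
  · simp

lemma span_normalizedCharacter_closure_eq_top :
    (Submodule.span ℂ (range normalizedCharacter)).topologicalClosure = ⊤ := by
  have h : (Submodule.span ℂ (range characterLp)).topologicalClosure = ⊤ := by
    simpa only [Submodule.map_span, ContinuousLinearMap.coe_coe, ← range_comp,
      Function.comp_def] using
      (ContinuousMap.toLp_denseRange ℂ volume ℂ (p := 2) (by simp)
        ).topologicalClosure_map_submodule span_character_closure_eq_top
  rw [← h]
  congr 1
  have hpi : (2 * Real.pi : ℂ) ≠ 0 := by exact_mod_cast Real.two_pi_pos.ne'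
  apply le_antisymm <;> rw [Submodule.span_le] <;> rintro _ ⟨k, rfl⟩
  · exact Submodule.smul_mem _ _ (Submodule.subset_span ⟨k, rfl⟩)
  · have : characterLp k = (2 * Real.pi : ℂ) • normalizedCharacter k := by
      rw [normalizedCharacter, smul_smul, mul_inv_cancel₀ hpi, one_smul]
    rw [this]
    exact Submodule.smul_mem _ _ (Submodule.subset_span ⟨k, rfl⟩)

/-- The Hilbert basis of normalized characters. -/
noncomputable def characterBasis :
    HilbertBasis (Fin 2 → ℤ) ℂ (Lp ℂ 2 (volume : Measure Torus)) :=
  HilbertBasis.mk orthonormal_normalizedCharacter span_normalizedCharacter_closure_eq_top.ge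

lemma coe_characterBasis (k : Fin 2 → ℤ) : characterBasis k = normalizedCharacter k :=
  congrFun (HilbertBasis.coe_mk _ _) k

/-! ### Fourier coefficients on the state space -/

/-- The inclusion of the state space into the complex space `L²`. -/
noncomputable def toComplex : H →L[ℝ] Lp ℂ 2 (volume : Measure Torus) :=
  (Complex.ofRealCLM.compLpL 2 volume).comp meanZero.subtypeL

lemma coeFn_toComplex (w : H) :
    toComplex w =ᵐ[volume] fun x => (((w : Lp ℝ 2 (volume : Measure Torus)) x : ℝ) : ℂ) :=
  Complex.ofRealCLM.coeFn_compLpL (w : Lp ℝ 2 (volume : Measure Torus))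

lemma coeff_eq_inner (w : H) (k : Fin 2 → ℤ) :
    coeff w k = (4 * (Real.pi : ℂ) ^ 2)⁻¹ * inner ℂ (characterLp k) (toComplex w) := by
  rw [coeff, inner_characterLp]
  congr 1
  refine integral_congr_ae ?_
  filter_upwards [coeFn_toComplex w] with x hx
  rw [hx]

lemma coeff_add (u v : H) (k : Fin 2 → ℤ) : coeff (u + v) k = coeff u k + coeff v k := by
  simp only [coeff_eq_inner, map_add, inner_add_right, mul_add]

lemma coeff_sub (u v : H) (k : Fin 2 → ℤ) : coeff (u - v) k = coeff u k - coeff v k := by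
  simp only [coeff_eq_inner, map_sub, inner_sub_right, mul_sub]

lemma coeff_smul (c : ℝ) (u : H) (k : Fin 2 → ℤ) : coeff (c • u) k = c * coeff u k := by
  have : toComplex (c • u) = (c : ℂ) • toComplex u := by
    rw [map_smul]; rfl
  simp only [coeff_eq_inner, this, inner_smul_right]
  ring

lemma coeff_neg (w : H) (k : Fin 2 → ℤ) : coeff w (-k) = conj (coeff w k) := by
  simp only [coeff, map_mul, ← integral_conj, neg_neg]
  congr 1
  · simp only [map_inv₀, map_mul, map_pow, Complex.conj_ofReal, map_ofNat]
  · refine integral_congr_ae (ae_of_all _ fun x => ?_)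
    simp [character_neg]

lemma coeff_zero_right (w : H) : coeff w 0 = 0 := by
  have h : ∫ x, (w : Lp ℝ 2 (volume : Measure Torus)) x = 0 := w.2
  simp [coeff, character_zero, integral_complex_ofReal, h]

lemma inner_toComplex (u v : H) :
    inner ℂ (toComplex u) (toComplex v) = ((inner ℝ u v : ℝ) : ℂ) := by
  rw [L2.inner_def, Submodule.coe_inner, L2.inner_def, ← integral_complex_ofReal]
  refine integral_congr_ae ?_
  filter_upwards [coeFn_toComplex u, coeFn_toComplex v] with x hx hy
  rw [hx, hy]
  simp

lemma inner_normalizedCharacter (w : H) (k : Fin 2 → ℤ) :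
    inner ℂ (normalizedCharacter k) (toComplex w) = 2 * Real.pi * coeff w k := by
  have hpi : (Real.pi : ℂ) ≠ 0 := by exact_mod_cast Real.pi_ne_zero
  rw [coeff_eq_inner, normalizedCharacter, inner_smul_left]
  simp only [map_inv₀, map_mul, Complex.conj_ofReal, map_ofNat]
  field_simp
  ring

lemma hasSum_inner (u v : H) :
    HasSum (fun k => 4 * Real.pi ^ 2 * (conj (coeff u k) * coeff v k).re) (inner ℝ u v) := by
  have h := characterBasis.hasSum_inner_mul_inner (toComplex u) (toComplex v)
  have h2 := RCLike.hasSum_re ℂ h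
  rw [inner_toComplex] at h2
  simp only [coe_characterBasis] at h2
  simp_rw [inner_normalizedCharacter, ← inner_conj_symm (toComplex u),
    inner_normalizedCharacter] at h2
  convert! h2 using 2 with k
  rw [map_mul (starRingEnd ℂ), map_mul (starRingEnd ℂ), Complex.conj_ofReal, map_ofNat]
  have : (2 * Real.pi * conj (coeff u k) * (2 * Real.pi * coeff v k) : ℂ)
    = ((4 * Real.pi ^ 2 : ℝ) : ℂ) * (conj (coeff u k) * coeff v k) := by push_cast; ring
  rw [this]
  exact (Complex.re_ofReal_mul _ _).symm

lemma hasSum_norm_sq (u : H) :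
    HasSum (fun k => 4 * Real.pi ^ 2 * ‖coeff u k‖ ^ 2) (‖u‖ ^ 2) := by
  have h := hasSum_inner u u
  rw [real_inner_self_eq_norm_sq] at h
  convert! h using 3 with k
  rw [← Complex.normSq_eq_conj_mul_self, Complex.ofReal_re, Complex.normSq_eq_norm_sq]

lemma summable_coeff_sq (u : H) : Summable fun k => ‖coeff u k‖ ^ 2 := by
  refine (summable_mul_left_iff (a := 4 * Real.pi ^ 2) (by positivity)).mp
    (hasSum_norm_sq u).summable

lemma ext_coeff {u v : H} (h : ∀ k, coeff u k = coeff v k) : u = v := by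
  have h0 := hasSum_norm_sq (u - v)
  simp only [coeff_sub, h, sub_self, norm_zero, ne_eq, OfNat.ofNat_ne_zero, not_false_eq_true,
    zero_pow, mul_zero] at h0
  have := h0.unique hasSum_zero
  rw [← sub_eq_zero, ← norm_eq_zero]
  exact pow_eq_zero_iff (two_ne_zero) |>.mp this

/-- Riesz–Fischer: every square summable Hermitian family with vanishing zeroth member is the
family of Fourier coefficients of an element of the state space. -/
lemma exists_coeff_eq (c : (Fin 2 → ℤ) → ℂ) (hc : ∀ k, c (-k) = conj (c k)) (h0 : c 0 = 0)
    (hs : Summable fun k => ‖c k‖ ^ 2) :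
    ∃ w : H, (∀ k, coeff w k = c k) ∧ (w : Lp ℝ 2 (volume : Measure Torus)) =ᵐ[volume]
      fun x => ((∑' k, c k • characterLp k : Lp ℂ 2 (volume : Measure Torus)) x).re := by
  have hpi : (2 * Real.pi : ℂ) ≠ 0 := by exact_mod_cast Real.two_pi_pos.ne'
  have hsum : Summable fun k => c k • characterLp k := by
    have h1 : Summable fun k => ‖2 * Real.pi * c k‖ ^ 2 := by
      simp only [norm_mul, mul_pow]
      exact hs.mul_left _
    have h2 := (orthonormal_normalizedCharacter.orthogonalFamily.summable_iff_norm_sq_summable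
      (fun k => 2 * Real.pi * c k)).mpr h1
    convert! h2 using 2 with k
    rw [LinearIsometry.toSpanSingleton_apply, show normalizedCharacter k =
      ((2 * Real.pi : ℂ)⁻¹) • characterLp k from rfl, smul_smul]
    congr 1
    field_simp
  set G : Lp ℂ 2 (volume : Measure Torus) := ∑' k, c k • characterLp k with hG
  have hcoef (k : Fin 2 → ℤ) : ∫ x, character (-k) x * G x = 4 * Real.pi ^ 2 * c k := by
    rw [← inner_characterLp]
    have := (hsum.hasSum.mapL (innerSL ℂ (characterLp k))).tsum_eq
    rw [innerSL_apply_apply] at this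
    rw [← this, tsum_eq_single k]
    · rw [innerSL_apply_apply, inner_smul_right, inner_characterLp_characterLp, if_pos rfl]
      ring
    · intro l hl
      rw [innerSL_apply_apply, inner_smul_right, inner_characterLp_characterLp, if_neg hl.symm,
        mul_zero]
  have hGi (k : Fin 2 → ℤ) : Integrable (fun x => character (-k) x * G x) volume := by
    refine ((Lp.memLp G).integrable (by norm_num)).bdd_mul (c := 1)
      (character (-k)).continuous.aestronglyMeasurable ?_
    exact ae_of_all _ fun x => (norm_character_apply _ _).le
  set g : Lp ℝ 2 (volume : Measure Torus) := Complex.reCLM.compLp G with hg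
  have hgG : g =ᵐ[volume] fun x => (G x).re := Complex.reCLM.coeFn_compLp G
  have hint (k : Fin 2 → ℤ) : ∫ x, character (-k) x * ((g x : ℝ) : ℂ) = 4 * Real.pi ^ 2 * c k := by
    have h1 : ∫ x, character (-k) x * ((g x : ℝ) : ℂ) =
        ∫ x, ((1 / 2 : ℂ) * (character (-k) x * G x) +
          (1 / 2 : ℂ) * conj (character (- -k) x * G x)) := by
      refine integral_congr_ae ?_
      filter_upwards [hgG] with x hx
      rw [hx, Complex.re_eq_add_conj, map_mul, ← character_neg, neg_neg]
      ring
    have h2 : Integrable (fun x => conj (character (- -k) x * G x)) volume :=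
      (LinearIsometryEquiv.integrable_comp_iff Complex.conjLIE).mpr (hGi (-k))
    rw [h1, integral_add ((hGi k).const_mul _) (h2.const_mul _), integral_const_mul,
      integral_const_mul, integral_conj, hcoef, hcoef, hc]
    simp only [map_mul, map_pow, Complex.conj_ofReal, map_ofNat, Complex.conj_conj]
    ring
  have hmean : g ∈ meanZero := by
    have h := hint 0
    simp only [neg_zero, character_zero, ContinuousMap.one_apply, one_mul, h0, mul_zero] at h
    rw [integral_complex_ofReal] at h
    exact_mod_cast h
  refine ⟨⟨g, hmean⟩, fun k => ?_, hgG⟩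
  rw [coeff, hint]
  have : (4 * (Real.pi : ℂ) ^ 2) ≠ 0 := by
    have : (Real.pi : ℂ) ≠ 0 := by exact_mod_cast Real.pi_ne_zero
    simp [this]
  field_simp

/-! ### Fourier multipliers -/

/-- A multiplier symbol which is bounded by one and maps real functions to real functions. -/
structure IsSymbol (m : (Fin 2 → ℤ) → ℂ) : Prop where
  neg : ∀ k, m (-k) = conj (m k)
  norm_le : ∀ k, ‖m k‖ ≤ 1

lemma IsSymbol.exists_clm {m : (Fin 2 → ℤ) → ℂ} (hm : IsSymbol m) :
    ∃ T : H →L[ℝ] H, (∀ w k, coeff (T w) k = m k * coeff w k) ∧ ‖T‖ ≤ 1 := by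
  have hle (w : H) (k : Fin 2 → ℤ) : ‖m k * coeff w k‖ ^ 2 ≤ ‖coeff w k‖ ^ 2 := by
    rw [norm_mul, mul_pow]
    exact mul_le_of_le_one_left (by positivity) (pow_le_one₀ (norm_nonneg _) (hm.norm_le k))
  have h (w : H) : ∃ v : H, ∀ k, coeff v k = m k * coeff w k := by
    obtain ⟨v, hv, -⟩ := exists_coeff_eq (fun k => m k * coeff w k)
      (fun k => by rw [hm.neg, coeff_neg, map_mul]) (by rw [coeff_zero_right, mul_zero])
      (Summable.of_nonneg_of_le (fun _ => by positivity) (hle w) (summable_coeff_sq w))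
    exact ⟨v, hv⟩
  choose T hT using h
  let L : H →ₗ[ℝ] H :=
    { toFun := T
      map_add' := fun u v => ext_coeff fun k => by simp only [hT, coeff_add, mul_add]
      map_smul' := fun c u => ext_coeff fun k => by
        simp only [hT, coeff_smul, RingHom.id_apply]; ring }
  have hL (w : H) : ‖L w‖ ≤ 1 * ‖w‖ := by
    rw [one_mul, ← abs_norm (L w), ← abs_norm w, ← sq_le_sq]
    refine hasSum_le (fun k => ?_) (hasSum_norm_sq (L w)) (hasSum_norm_sq w)
    change 4 * Real.pi ^ 2 * ‖coeff (T w) k‖ ^ 2 ≤ _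
    rw [hT]
    gcongr 4 * Real.pi ^ 2 * ?_
    exact hle w k
  exact ⟨L.mkContinuous 1 hL, hT, L.mkContinuous_norm_le zero_le_one hL⟩

open Classical in
/-- The Fourier multiplier with symbol `m` as an operator on the state space; it is zero unless `m`
is the symbol of a bounded operator. -/
noncomputable def fourierMul (m : (Fin 2 → ℤ) → ℂ) : H →L[ℝ] H :=
  if h : IsSymbol m then h.exists_clm.choose else 0

lemma coeff_fourierMul {m : (Fin 2 → ℤ) → ℂ} (hm : IsSymbol m) (w : H) (k : Fin 2 → ℤ) :
    coeff (fourierMul m w) k = m k * coeff w k := by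
  rw [fourierMul, dif_pos hm]
  exact hm.exists_clm.choose_spec.1 w k

lemma norm_fourierMul_le (m : (Fin 2 → ℤ) → ℂ) (w : H) : ‖fourierMul m w‖ ≤ ‖w‖ := by
  have : ‖fourierMul m‖ ≤ 1 := by
    rw [fourierMul]
    split_ifs with h
    · exact h.exists_clm.choose_spec.2
    · exact ContinuousLinearMap.opNorm_zero.trans_le zero_le_one
  exact (ContinuousLinearMap.le_of_opNorm_le _ this w).trans_eq (one_mul _)

lemma multiplier_ae_eq {m : (Fin 2 → ℤ) → ℂ} {v w : H} (h : ∀ k, coeff v k = m k * coeff w k) :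
    multiplier m w =ᵐ[volume] (v : Lp ℝ 2 (volume : Measure Torus)) := by
  obtain ⟨v', hv', hae⟩ := exists_coeff_eq (fun k => m k * coeff w k)
    (fun k => by rw [← h, ← h, coeff_neg]) (by rw [coeff_zero_right, mul_zero])
    (by simp only [← h]; exact summable_coeff_sq v)
  have hvv : v' = v := ext_coeff fun k => by rw [h, hv']
  rw [← hvv]
  exact hae.symm

/-! ### Uniformly convergent Fourier series -/

/-- The Fourier series `∑ c(k) exp (i k·x)` with uniform convergence. -/
noncomputable def fourierSeries (c : (Fin 2 → ℤ) → ℂ) : C(Torus, ℂ) := ∑' k, c k • character k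

lemma norm_smul_character_le (c : (Fin 2 → ℤ) → ℂ) (k : Fin 2 → ℤ) :
    ‖c k • character k‖ ≤ ‖c k‖ := by
  rw [norm_smul]
  exact mul_le_of_le_one_right (norm_nonneg _) (norm_character_le k)

lemma summable_norm_smul_character {c : (Fin 2 → ℤ) → ℂ} (hc : Summable fun k => ‖c k‖) :
    Summable fun k => ‖c k • character k‖ :=
  Summable.of_nonneg_of_le (fun _ => norm_nonneg _) (norm_smul_character_le c) hc

lemma summable_mul_coeff {m : (Fin 2 → ℤ) → ℂ} (hm : Summable fun k => ‖m k‖ ^ 2) (w : H) :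
    Summable (fun k => ‖m k * coeff w k‖) ∧
      ∑' k, ‖m k * coeff w k‖ ≤ √(∑' k, ‖m k‖ ^ 2) * ‖w‖ := by
  have h := Real.summable_and_inner_le_Lp_mul_Lq_tsum_of_nonneg
    (f := fun k => ‖m k‖) (g := fun k => ‖coeff w k‖) (p := 2) (q := 2)
    Real.HolderConjugate.two_two (fun _ => norm_nonneg _) (fun _ => norm_nonneg _)
    (by simpa only [Real.rpow_two] using hm)
    (by simpa only [Real.rpow_two] using summable_coeff_sq w)
  simp only [← norm_mul, Real.rpow_two, ← Real.sqrt_eq_rpow] at h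
  refine ⟨h.1, h.2.trans ?_⟩
  gcongr
  rw [Real.sqrt_le_left (norm_nonneg _)]
  refine hasSum_le (fun k => ?_) (summable_coeff_sq w).hasSum (hasSum_norm_sq w)
  have : 1 ≤ 4 * Real.pi ^ 2 := by nlinarith [Real.pi_gt_three]
  exact le_mul_of_one_le_left (by positivity) this

lemma hasSum_fourierSeries {c : (Fin 2 → ℤ) → ℂ} (hc : Summable fun k => ‖c k‖) :
    HasSum (fun k => c k • character k) (fourierSeries c) :=
  (summable_norm_smul_character hc).of_norm.hasSum

lemma norm_fourierSeries_le {c : (Fin 2 → ℤ) → ℂ} (hc : Summable fun k => ‖c k‖) :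
    ‖fourierSeries c‖ ≤ ∑' k, ‖c k‖ :=
  tsum_of_norm_bounded hc.hasSum (norm_smul_character_le c)

lemma fourierSeries_conj {c : (Fin 2 → ℤ) → ℂ} (hc : ∀ k, c (-k) = conj (c k))
    (hs : Summable fun k => ‖c k‖) (x : Torus) :
    conj (fourierSeries c x) = fourierSeries c x := by
  have h1 : HasSum (fun k => c k * character k x) (fourierSeries c x) :=
    (hasSum_fourierSeries hs).mapL (ContinuousMap.evalCLM ℂ x)
  have h2 : HasSum (fun k => conj (c k * character k x)) (conj (fourierSeries c x)) :=
    h1.map (starRingEnd ℂ : ℂ →+* ℂ) Complex.continuous_conj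
  have h3 := (Equiv.neg (Fin 2 → ℤ)).hasSum_iff.mpr h2
  refine h3.unique ?_
  convert! h1 using 2 with k
  simp [hc, character_neg]

/-- The real part of a uniformly convergent multiplier series, as a linear map. -/
noncomputable def fourierContLinear (m : (Fin 2 → ℤ) → ℂ) (hm : Summable fun k => ‖m k‖ ^ 2) :
    H →ₗ[ℝ] C(Torus, ℝ) where
  toFun w := Complex.reCLM.compLeftContinuous ℝ Torus (fourierSeries fun k => m k * coeff w k)
  map_add' u v := by
    rw [← map_add]
    congr 1
    refine (hasSum_fourierSeries (summable_mul_coeff hm (u + v)).1).unique ?_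
    convert! (hasSum_fourierSeries (summable_mul_coeff hm u).1).add
      (hasSum_fourierSeries (summable_mul_coeff hm v).1) using 2 with k
    rw [coeff_add, mul_add, add_smul]
  map_smul' a u := by
    rw [RingHom.id_apply, ← map_smul]
    congr 1
    refine (hasSum_fourierSeries (summable_mul_coeff hm (a • u)).1).unique ?_
    convert! (hasSum_fourierSeries (summable_mul_coeff hm u).1).const_smul a using 2 with k
    rw [coeff_smul, mul_left_comm, mul_smul]
    rfl

/-- The Fourier multiplier with a square summable symbol, as an operator from the state space to
the continuous functions. -/
noncomputable def fourierCont (m : (Fin 2 → ℤ) → ℂ) (hm : Summable fun k => ‖m k‖ ^ 2) :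
    H →L[ℝ] C(Torus, ℝ) :=
  (fourierContLinear m hm).mkContinuous (√(∑' k, ‖m k‖ ^ 2)) fun w => by
    refine (ContinuousMap.norm_le _ (by positivity)).mpr fun x => ?_
    refine (Complex.abs_re_le_norm _).trans ((ContinuousMap.norm_coe_le_norm _ x).trans ?_)
    exact (norm_fourierSeries_le (summable_mul_coeff hm w).1).trans (summable_mul_coeff hm w).2

lemma ofReal_fourierCont {m : (Fin 2 → ℤ) → ℂ} (hm : Summable fun k => ‖m k‖ ^ 2)
    (hn : ∀ k, m (-k) = conj (m k)) (w : H) (x : Torus) :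
    ((fourierCont m hm w x : ℝ) : ℂ) = fourierSeries (fun k => m k * coeff w k) x :=
  Complex.conj_eq_iff_re.mp <| fourierSeries_conj
    (fun k => by rw [hn, coeff_neg, map_mul]) (summable_mul_coeff hm w).1 x

lemma fourierCont_ae_eq {m : (Fin 2 → ℤ) → ℂ} (hm : Summable fun k => ‖m k‖ ^ 2) {v w : H}
    (h : ∀ k, coeff v k = m k * coeff w k) :
    (v : Lp ℝ 2 (volume : Measure Torus)) =ᵐ[volume] fourierCont m hm w := by
  refine (multiplier_ae_eq h).symm.trans ?_
  have hs := (hasSum_fourierSeries (summable_mul_coeff hm w).1).mapL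
    (ContinuousMap.toLp 2 (volume : Measure Torus) ℂ)
  simp only [map_smul] at hs
  have h1 := ContinuousMap.coeFn_toLp (𝕜 := ℂ) (p := 2) (volume : Measure Torus)
    (fourierSeries fun k => m k * coeff w k)
  filter_upwards [h1] with x hx
  rw [multiplier, hs.tsum_eq]
  exact congrArg Complex.re hx

/-! ### The differential operators as bounded operators -/

/-- `|k|`. -/
noncomputable def freq (k : Fin 2 → ℤ) : ℝ := √(normSq k)

/-- The symbol `|k|⁻³` of `(-Δ)^(-3/2)`. -/
noncomputable def smoothSymbol (k : Fin 2 → ℤ) : ℂ := (((freq k) ^ 3)⁻¹ : ℝ)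

/-- The symbol of `∂_j`. -/
noncomputable def derivSymbol (j : Fin 2) (k : Fin 2 → ℤ) : ℂ := Complex.I * (k j : ℂ)

/-- The symbol of the `j`-th component of the Biot-Savart operator. -/
noncomputable def velocitySymbol (j : Fin 2) (k : Fin 2 → ℤ) : ℂ :=
  (![Complex.I * (k 1 : ℂ), -(Complex.I * (k 0 : ℂ))] j) / (normSq k : ℂ)

lemma normSq_nonneg (k : Fin 2 → ℤ) : 0 ≤ normSq k := by unfold normSq; positivity

lemma freq_nonneg (k : Fin 2 → ℤ) : 0 ≤ freq k := Real.sqrt_nonneg _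

lemma freq_sq (k : Fin 2 → ℤ) : freq k ^ 2 = normSq k := Real.sq_sqrt (normSq_nonneg k)

lemma normSq_neg (k : Fin 2 → ℤ) : normSq (-k) = normSq k := by simp [normSq]

lemma freq_neg (k : Fin 2 → ℤ) : freq (-k) = freq k := by rw [freq, freq, normSq_neg]

lemma one_le_freq {k : Fin 2 → ℤ} (hk : k ≠ 0) : 1 ≤ freq k := by
  rw [freq, Real.one_le_sqrt, normSq]
  have h : k 0 ≠ 0 ∨ k 1 ≠ 0 := by
    by_contra! h
    exact hk (funext fun i => by fin_cases i <;> simp [h])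
  have h1 : 1 ≤ (k 0) ^ 2 + (k 1) ^ 2 := by
    rcases h with h | h <;> have := sq_pos_of_ne_zero h <;>
      nlinarith [sq_nonneg (k 0), sq_nonneg (k 1)]
  exact_mod_cast h1

lemma freq_zero : freq 0 = 0 := by simp [freq, normSq]

lemma abs_le_freq (k : Fin 2 → ℤ) (j : Fin 2) : |(k j : ℝ)| ≤ freq k := by
  rw [freq]
  refine Real.abs_le_sqrt ?_
  rw [normSq]
  fin_cases j
  · exact le_add_of_nonneg_right (sq_nonneg _)
  · exact le_add_of_nonneg_left (sq_nonneg _)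

lemma norm_smoothSymbol (k : Fin 2 → ℤ) : ‖smoothSymbol k‖ = (freq k ^ 3)⁻¹ := by
  rw [smoothSymbol, Complex.norm_real, Real.norm_of_nonneg]
  have := freq_nonneg k
  positivity

lemma norm_derivSymbol (j : Fin 2) (k : Fin 2 → ℤ) : ‖derivSymbol j k‖ = |(k j : ℝ)| := by
  rw [derivSymbol, norm_mul, Complex.norm_I, one_mul, Complex.norm_intCast]

lemma norm_velocitySymbol_sq (j : Fin 2) (k : Fin 2 → ℤ) :
    ‖velocitySymbol j k‖ ^ 2 = ((![(k 1 : ℝ), (k 0 : ℝ)] j) / normSq k) ^ 2 := by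
  rw [velocitySymbol, norm_div, Complex.norm_real, Real.norm_of_nonneg (normSq_nonneg k), div_pow,
    div_pow]
  congr 1
  fin_cases j <;> simp

lemma smoothSymbol_neg (k : Fin 2 → ℤ) : smoothSymbol (-k) = conj (smoothSymbol k) := by
  rw [smoothSymbol, smoothSymbol, freq_neg, Complex.conj_ofReal]

lemma derivSymbol_neg (j : Fin 2) (k : Fin 2 → ℤ) :
    derivSymbol j (-k) = conj (derivSymbol j k) := by
  simp [derivSymbol]

lemma velocitySymbol_neg (j : Fin 2) (k : Fin 2 → ℤ) :
    velocitySymbol j (-k) = conj (velocitySymbol j k) := by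
  rw [velocitySymbol, velocitySymbol, normSq_neg, map_div₀, Complex.conj_ofReal]
  congr 1
  fin_cases j <;> simp

lemma isSymbol_smooth : IsSymbol smoothSymbol where
  neg := smoothSymbol_neg
  norm_le k := by
    rw [norm_smoothSymbol]
    rcases eq_or_ne k 0 with rfl | hk
    · simp [freq_zero]
    · exact inv_le_one_of_one_le₀ (one_le_pow₀ (one_le_freq hk))

lemma norm_derivSymbol_mul_le (j : Fin 2) (k : Fin 2 → ℤ) :
    ‖derivSymbol j k * smoothSymbol k‖ ≤ (freq k ^ 2)⁻¹ := by
  rw [norm_mul, norm_smoothSymbol, norm_derivSymbol]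
  rcases eq_or_ne k 0 with rfl | hk
  · simp [freq_zero]
  · have h := one_le_freq hk
    rw [mul_inv_le_iff₀ (by positivity)]
    refine (abs_le_freq k j).trans_eq ?_
    field_simp

lemma norm_smoothSymbol_le (k : Fin 2 → ℤ) : ‖smoothSymbol k‖ ≤ (freq k ^ 2)⁻¹ := by
  rw [norm_smoothSymbol]
  rcases eq_or_ne k 0 with rfl | hk
  · simp [freq_zero]
  · have h := one_le_freq hk
    gcongr
    norm_num

lemma inv_freq_sq_le_one (k : Fin 2 → ℤ) : (freq k ^ 2)⁻¹ ≤ 1 := by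
  rcases eq_or_ne k 0 with rfl | hk
  · simp [freq_zero]
  · exact inv_le_one_of_one_le₀ (one_le_pow₀ (one_le_freq hk))

lemma isSymbol_deriv (j : Fin 2) : IsSymbol fun k => derivSymbol j k * smoothSymbol k where
  neg k := by rw [derivSymbol_neg, smoothSymbol_neg, map_mul]
  norm_le k := (norm_derivSymbol_mul_le j k).trans (inv_freq_sq_le_one k)

lemma isSymbol_velocity (j : Fin 2) : IsSymbol (velocitySymbol j) where
  neg := velocitySymbol_neg j
  norm_le k := by
    rw [← abs_norm, ← sq_le_one_iff_abs_le_one, norm_velocitySymbol_sq]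
    rcases eq_or_ne k 0 with rfl | hk
    · simp [normSq]
    · have h := one_le_freq hk
      have h2 : 1 ≤ normSq k := by rw [← freq_sq]; exact one_le_pow₀ h
      rw [div_pow, div_le_one (by positivity)]
      have : (![(k 1 : ℝ), (k 0 : ℝ)] j) ^ 2 ≤ normSq k := by
        rw [normSq]
        fin_cases j <;> simp <;> positivity
      nlinarith

lemma isSymbol_laplacian : IsSymbol fun k => -(normSq k : ℂ) * smoothSymbol k where
  neg k := by rw [normSq_neg, smoothSymbol_neg, map_mul, map_neg, Complex.conj_ofReal]
  norm_le k := by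
    rw [norm_mul, norm_smoothSymbol, norm_neg, Complex.norm_real,
      Real.norm_of_nonneg (normSq_nonneg k), ← freq_sq]
    rcases eq_or_ne k 0 with rfl | hk
    · simp [freq_zero]
    · have h := one_le_freq hk
      rw [mul_inv_le_iff₀ (by positivity), one_mul]
      exact pow_le_pow_right₀ h (by norm_num)

lemma summable_inv_freq : Summable fun k : Fin 2 → ℤ => ((freq k ^ 2)⁻¹) ^ 2 := by
  refine Summable.of_nonneg_of_le (fun _ => by positivity) (fun k => ?_)
    (EisensteinSeries.summable_one_div_norm_rpow (k := 4) (by norm_num))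
  rcases eq_or_ne k 0 with rfl | hk
  · have h0 : ((freq 0 ^ 2)⁻¹) ^ 2 = 0 := by simp [freq_zero]
    rw [h0]
    positivity
  · have h : ‖k‖ ≤ freq k := by
      refine (pi_norm_le_iff_of_nonneg (freq_nonneg k)).mpr fun j => ?_
      rw [Int.norm_eq_abs]
      exact abs_le_freq k j
    have h0 : 0 < ‖k‖ := norm_pos_iff.mpr hk
    rw [Real.rpow_neg (norm_nonneg _), inv_pow, ← pow_mul,
      show (4 : ℝ) = ((2 * 2 : ℕ) : ℝ) by norm_num, Real.rpow_natCast]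
    gcongr

lemma summable_smoothSymbol : Summable fun k => ‖smoothSymbol k‖ ^ 2 :=
  Summable.of_nonneg_of_le (fun _ => by positivity)
    (fun k => pow_le_pow_left₀ (norm_nonneg _) (norm_smoothSymbol_le k) 2) summable_inv_freq

lemma summable_derivSymbol (j : Fin 2) :
    Summable fun k => ‖derivSymbol j k * smoothSymbol k‖ ^ 2 :=
  Summable.of_nonneg_of_le (fun _ => by positivity)
    (fun k => pow_le_pow_left₀ (norm_nonneg _) (norm_derivSymbol_mul_le j k) 2) summable_inv_freq

/-- `(-Δ)^(-3/2)`, an isometry of the state space onto the space `H₃`. Elements of `H₃` are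
represented below as `smoothing h`, which makes all operators of the equation bounded
operators of `h`. -/
noncomputable def smoothing : H →L[ℝ] H := fourierMul smoothSymbol

/-- `∂_j` composed with `smoothing`. -/
noncomputable def gradOp (j : Fin 2) : H →L[ℝ] H :=
  fourierMul fun k => derivSymbol j k * smoothSymbol k

/-- `Δ` composed with `smoothing`. -/
noncomputable def laplacianOp : H →L[ℝ] H := fourierMul fun k => -(normSq k : ℂ) * smoothSymbol k

/-- The `j`-th component of the Biot-Savart operator on the state space. -/
noncomputable def velocityOp (j : Fin 2) : H →L[ℝ] H := fourierMul (velocitySymbol j)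

/-- `smoothing` with values in the continuous functions. -/
noncomputable def smoothingCont : H →L[ℝ] C(Torus, ℝ) := fourierCont _ summable_smoothSymbol

/-- `∂_j` composed with `smoothing`, with values in the continuous functions. -/
noncomputable def gradCont (j : Fin 2) : H →L[ℝ] C(Torus, ℝ) :=
  fourierCont _ (summable_derivSymbol j)

/-- The square of the norm of `smoothing h` in `H₁`. -/
noncomputable def dirichlet (h : H) : ℝ := ∑ j, ‖gradOp j h‖ ^ 2

lemma coeff_smoothing (h : H) (k : Fin 2 → ℤ) :
    coeff (smoothing h) k = smoothSymbol k * coeff h k := coeff_fourierMul isSymbol_smooth h k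

lemma coeff_gradOp (j : Fin 2) (h : H) (k : Fin 2 → ℤ) :
    coeff (gradOp j h) k = derivSymbol j k * smoothSymbol k * coeff h k :=
  coeff_fourierMul (isSymbol_deriv j) h k

lemma coeff_laplacianOp (h : H) (k : Fin 2 → ℤ) :
    coeff (laplacianOp h) k = -(normSq k : ℂ) * smoothSymbol k * coeff h k :=
  coeff_fourierMul isSymbol_laplacian h k

lemma coeff_velocityOp (j : Fin 2) (h : H) (k : Fin 2 → ℤ) :
    coeff (velocityOp j h) k = velocitySymbol j k * coeff h k :=
  coeff_fourierMul (isSymbol_velocity j) h k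

lemma smoothing_ae_eq (h : H) :
    (smoothing h : Lp ℝ 2 (volume : Measure Torus)) =ᵐ[volume] smoothingCont h :=
  fourierCont_ae_eq _ (coeff_smoothing h)

lemma gradOp_ae_eq (j : Fin 2) (h : H) :
    (gradOp j h : Lp ℝ 2 (volume : Measure Torus)) =ᵐ[volume] gradCont j h :=
  fourierCont_ae_eq _ (coeff_gradOp j h)

lemma partialDeriv_ae_eq (j : Fin 2) (h : H) :
    partialDeriv j (smoothing h) =ᵐ[volume] gradCont j h :=
  (multiplier_ae_eq fun k => by
    rw [coeff_gradOp, coeff_smoothing, derivSymbol, mul_assoc]).trans (gradOp_ae_eq j h)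

lemma laplacian_ae_eq (h : H) :
    laplacian (smoothing h) =ᵐ[volume] (laplacianOp h : Lp ℝ 2 (volume : Measure Torus)) :=
  multiplier_ae_eq fun k => by rw [coeff_laplacianOp, coeff_smoothing, mul_assoc]

lemma velocity_ae_eq (j : Fin 2) (h : H) :
    velocity (smoothing h) j =ᵐ[volume] smoothingCont (velocityOp j h) :=
  (multiplier_ae_eq fun k => by
    rw [coeff_smoothing, coeff_velocityOp, coeff_smoothing, velocitySymbol, mul_left_comm]).trans
    (smoothing_ae_eq _)

lemma velocityOp_smoothing (j : Fin 2) (h : H) :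
    velocityOp j (smoothing h) = smoothing (velocityOp j h) :=
  ext_coeff fun k => by
    rw [coeff_velocityOp, coeff_smoothing, coeff_smoothing, coeff_velocityOp, mul_left_comm]

lemma norm_smoothing_le (h : H) : ‖smoothing h‖ ≤ ‖h‖ := norm_fourierMul_le _ h

lemma norm_laplacianOp_le (h : H) : ‖laplacianOp h‖ ≤ ‖h‖ := norm_fourierMul_le _ h

lemma dirichlet_nonneg (h : H) : 0 ≤ dirichlet h := Finset.sum_nonneg fun _ _ => sq_nonneg _

lemma hasSum_dirichlet (h : H) :
    HasSum (fun k => 4 * Real.pi ^ 2 * (normSq k * ‖coeff (smoothing h) k‖ ^ 2)) (dirichlet h) := by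
  have := hasSum_sum (s := (Finset.univ : Finset (Fin 2)))
    (fun j _ => hasSum_norm_sq (gradOp j h))
  convert! this using 2 with k
  rw [Fin.sum_univ_two, coeff_gradOp, coeff_gradOp, coeff_smoothing,
    mul_assoc (derivSymbol _ k), mul_assoc (derivSymbol _ k), norm_mul (derivSymbol _ k),
    norm_mul (derivSymbol _ k), norm_derivSymbol, norm_derivSymbol, mul_pow, mul_pow,
    sq_abs, sq_abs, normSq]
  ring

/-- The Poincaré inequality. -/
lemma norm_smoothing_sq_le (h : H) : ‖smoothing h‖ ^ 2 ≤ dirichlet h := by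
  refine hasSum_le (fun k => ?_) (hasSum_norm_sq _) (hasSum_dirichlet h)
  gcongr 4 * Real.pi ^ 2 * ?_
  rcases eq_or_ne k 0 with rfl | hk
  · simp [coeff_zero_right]
  · rw [← freq_sq]
    exact le_mul_of_one_le_left (by positivity) (one_le_pow₀ (one_le_freq hk))

lemma inner_laplacianOp (h : H) : inner ℝ (laplacianOp h) (smoothing h) = -dirichlet h := by
  refine (hasSum_inner _ _).unique ?_
  convert! (hasSum_dirichlet h).neg using 2 with k
  rw [coeff_laplacianOp, mul_assoc (-(normSq k : ℂ)), ← coeff_smoothing, map_mul, map_neg,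
    Complex.conj_ofReal,
    mul_assoc (-(normSq k : ℂ)), ← Complex.normSq_eq_conj_mul_self, Complex.normSq_eq_norm_sq,
    ← Complex.ofReal_neg,
    ← Complex.ofReal_mul, Complex.ofReal_re]
  ring

lemma sum_dirichlet_velocityOp_le (h : H) :
    ∑ j, dirichlet (velocityOp j h) ≤ ‖smoothing h‖ ^ 2 := by
  refine hasSum_le (fun k => ?_) (hasSum_sum fun j _ => hasSum_dirichlet (velocityOp j h))
    (hasSum_norm_sq _)
  simp only [coeff_smoothing, coeff_velocityOp, norm_mul, mul_pow, norm_velocitySymbol_sq,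
    Fin.sum_univ_two]
  rw [← mul_add]
  gcongr 4 * Real.pi ^ 2 * ?_
  rcases eq_or_ne k 0 with rfl | hk
  · simp [coeff_zero_right]
  · have h2 : 0 < normSq k := by
      rw [← freq_sq]
      have := one_le_freq hk
      positivity
    have h3 : ((k 1 : ℝ) / normSq k) ^ 2 + ((k 0 : ℝ) / normSq k) ^ 2 = (normSq k)⁻¹ := by
      field_simp
      rw [normSq]
      ring
    simp only [Matrix.cons_val_zero, Matrix.cons_val_one]
    refine le_of_eq ?_
    calc _ = normSq k * (((k 1 : ℝ) / normSq k) ^ 2 + ((k 0 : ℝ) / normSq k) ^ 2)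
          * (‖smoothSymbol k‖ ^ 2 * ‖coeff h k‖ ^ 2) := by ring
      _ = _ := by rw [h3, mul_inv_cancel₀ h2.ne', one_mul]

lemma sobolevNorm_eq {a : ℝ} {w : H} {S : ℝ} (hS : 0 ≤ S)
    (h : HasSum (fun k => 4 * Real.pi ^ 2 * normSq k ^ a * ‖coeff w k‖ ^ 2) (S ^ 2)) :
    sobolevNorm a w = ENNReal.ofReal S := by
  rw [sobolevNorm, ← ENNReal.ofReal_tsum_of_nonneg _ h.summable, h.tsum_eq,
    ENNReal.ofReal_rpow_of_nonneg (by positivity) (by norm_num), ← Real.sqrt_eq_rpow,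
    Real.sqrt_sq hS]
  intro k
  have := Real.rpow_nonneg (normSq_nonneg k) a
  positivity

lemma sobolevNorm_one_smoothing (h : H) :
    sobolevNorm 1 (smoothing h) = ENNReal.ofReal √(dirichlet h) := by
  refine sobolevNorm_eq (Real.sqrt_nonneg _) ?_
  rw [Real.sq_sqrt (dirichlet_nonneg h)]
  convert! hasSum_dirichlet h using 2 with k
  rw [Real.rpow_one, mul_assoc]

lemma normSq_rpow_three (k : Fin 2 → ℤ) : normSq k ^ (3 : ℝ) = freq k ^ 6 := by
  rw [← freq_sq, show (3 : ℝ) = ((3 : ℕ) : ℝ) by norm_num, Real.rpow_natCast, ← pow_mul]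

lemma sobolevNorm_three_smoothing (h : H) :
    sobolevNorm 3 (smoothing h) = ENNReal.ofReal ‖h‖ := by
  refine sobolevNorm_eq (norm_nonneg _) ?_
  convert! hasSum_norm_sq h using 2 with k
  rw [normSq_rpow_three, coeff_smoothing, norm_mul, norm_smoothSymbol]
  rcases eq_or_ne k 0 with rfl | hk
  · simp [coeff_zero_right]
  · have := one_le_freq hk
    field_simp

lemma summable_of_sobolevNorm_lt_top {a : ℝ} {w : H} (h : sobolevNorm a w < ∞) :
    Summable fun k => 4 * Real.pi ^ 2 * normSq k ^ a * ‖coeff w k‖ ^ 2 := by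
  rw [sobolevNorm, ENNReal.rpow_lt_top_iff_of_pos (by norm_num)] at h
  have h1 := ENNReal.summable_toReal h.ne
  refine h1.congr fun k => ENNReal.toReal_ofReal ?_
  have := Real.rpow_nonneg (normSq_nonneg k) a
  positivity

lemma exists_smoothing_eq {w : H} (h : sobolevNorm 3 w < ∞) : ∃ v, smoothing v = w := by
  have hs := summable_of_sobolevNorm_lt_top h
  obtain ⟨v, hv, -⟩ := exists_coeff_eq (fun k => ((freq k ^ 3 : ℝ) : ℂ) * coeff w k)
    (fun k => by rw [freq_neg, coeff_neg, map_mul, Complex.conj_ofReal])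
    (by rw [coeff_zero_right, mul_zero]) (by
      refine (summable_mul_left_iff (a := 4 * Real.pi ^ 2) (by positivity)).mp
        (hs.congr fun k => ?_)
      rw [normSq_rpow_three, norm_mul, Complex.norm_real, mul_pow, Real.norm_eq_abs, sq_abs]
      ring)
  refine ⟨v, ext_coeff fun k => ?_⟩
  rw [coeff_smoothing, hv, smoothSymbol, ← mul_assoc, ← Complex.ofReal_mul]
  rcases eq_or_ne k 0 with rfl | hk
  · simp [coeff_zero_right]
  · have := one_le_freq hk
    rw [inv_mul_cancel₀ (by positivity), Complex.ofReal_one, one_mul]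

/-- Smooth functions separate points: the truncations of `w` to a pair of frequencies suffice. -/
lemma eq_zero_of_inner_smooth {w : H} (h : ∀ φ, IsSmooth φ → inner ℝ w φ = 0) : w = 0 := by
  classical
  refine ext_coeff fun k₀ => ?_
  set s : Finset (Fin 2 → ℤ) := {k₀, -k₀} with hs
  have hneg (k : Fin 2 → ℤ) : -k ∈ s ↔ k ∈ s := by
    simp only [hs, Finset.mem_insert, Finset.mem_singleton, neg_eq_iff_eq_neg, neg_neg]
    tauto
  obtain ⟨φ, hφ, -⟩ := exists_coeff_eq (fun k => if k ∈ s then coeff w k else 0)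
    (fun k => by simp only [hneg, coeff_neg]; split_ifs <;> simp)
    (by simp [coeff_zero_right])
    (summable_of_ne_finset_zero (s := s) fun k hk => by simp [hk])
  have hsm : IsSmooth φ := by
    intro a _
    rw [sobolevNorm, ENNReal.rpow_lt_top_iff_of_pos (by norm_num),
      tsum_eq_sum (s := s) fun k hk => by simp [hφ, hk]]
    exact ENNReal.sum_lt_top.mpr fun k _ => ENNReal.ofReal_lt_top
  have h1 := hasSum_inner w φ
  rw [h φ hsm] at h1
  have hterm (k : Fin 2 → ℤ) : 4 * Real.pi ^ 2 * (conj (coeff w k) * coeff φ k).re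
      = if k ∈ s then 4 * Real.pi ^ 2 * ‖coeff w k‖ ^ 2 else 0 := by
    rw [hφ]
    split_ifs
    · rw [← Complex.normSq_eq_conj_mul_self, Complex.ofReal_re, Complex.normSq_eq_norm_sq]
    · simp
  simp only [hterm] at h1
  have h2 := (hasSum_zero_iff_of_nonneg (fun k => by positivity)).mp h1
  have h3 := congrFun h2 k₀
  have h4 : ‖coeff w k₀‖ ^ 2 = 0 := by simpa [hs, Real.pi_ne_zero] using h3
  have h5 : coeff w k₀ = 0 := by simpa using h4
  rw [h5, coeff_eq_inner, map_zero, inner_zero_right, mul_zero]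

/-! ### The nonlinear term -/

instance completeSpace_meanZero : CompleteSpace meanZero := by
  have h : (meanZero : Set (Lp ℝ 2 (volume : Measure Torus))) =
      {w | inner ℝ (ContinuousMap.toLp 2 (volume : Measure Torus) ℝ 1) w = 0} := by
    ext w
    change ∫ x, w x = 0 ↔ _
    rw [mem_ofPred_eq, L2.inner_def]
    refine Eq.congr_left (integral_congr_ae ?_)
    filter_upwards [ContinuousMap.coeFn_toLp (𝕜 := ℝ) (p := 2) (volume : Measure Torus)
      (1 : C(Torus, ℝ))] with x hx
    rw [hx]
    simp
  have hc : IsClosed (meanZero : Set (Lp ℝ 2 (volume : Measure Torus))) := by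
    rw [h]
    exact isClosed_eq (by fun_prop) continuous_const
  exact hc.completeSpace_coe

/-- A continuous function as an element of the state space, its mean being removed. -/
noncomputable def projCont : C(Torus, ℝ) →L[ℝ] H :=
  meanZero.orthogonalProjectionOnto.comp (ContinuousMap.toLp 2 (volume : Measure Torus) ℝ)

/-- The nonlinear term `B(𝒦 u, v)` for `u = smoothing a` and `v = smoothing b`. -/
noncomputable def advectionOp : H →L[ℝ] H →L[ℝ] H :=
  ∑ j, (ContinuousLinearMap.compL ℝ H C(Torus, ℝ) H projCont).comp
    ((ContinuousLinearMap.mul ℝ C(Torus, ℝ)).bilinearComp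
      (smoothingCont.comp (velocityOp j)) (gradCont j))

lemma advectionOp_apply (a b : H) :
    advectionOp a b = ∑ j, projCont (smoothingCont (velocityOp j a) * gradCont j b) := by
  simp [advectionOp]

lemma inner_projCont (f : C(Torus, ℝ)) (w : H) :
    inner ℝ (projCont f) w = ∫ x, f x * (w : Lp ℝ 2 (volume : Measure Torus)) x := by
  rw [projCont, ContinuousLinearMap.comp_apply,
    Submodule.inner_orthogonalProjectionOnto_eq_of_mem_right, L2.inner_def]
  refine integral_congr_ae ?_
  filter_upwards [ContinuousMap.coeFn_toLp (𝕜 := ℝ) (p := 2) (volume : Measure Torus) f] with x hx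
  rw [hx, real_inner_eq_re_inner ℝ, RCLike.inner_apply]
  simp [mul_comm]

lemma inner_projCont_smoothing (f : C(Torus, ℝ)) (c : H) :
    inner ℝ (projCont f) (smoothing c) = ∫ x, f x * smoothingCont c x := by
  rw [inner_projCont]
  refine integral_congr_ae ?_
  filter_upwards [smoothing_ae_eq c] with x hx
  rw [hx]

lemma integrable_cont_mul (f : C(Torus, ℝ)) (w : H) :
    Integrable (fun x => f x * (w : Lp ℝ 2 (volume : Measure Torus)) x) volume :=
  ((Lp.memLp (w : Lp ℝ 2 (volume : Measure Torus))).integrable (by norm_num)).bdd_mul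
    f.continuous.aestronglyMeasurable (ae_of_all _ fun x => f.norm_coe_le_norm x)

lemma integral_advection (a b φ : H) :
    ∫ x, advection (smoothing a) (smoothing b) x * (φ : Lp ℝ 2 (volume : Measure Torus)) x
      = inner ℝ (advectionOp a b) φ := by
  rw [advectionOp_apply, sum_inner]
  simp only [inner_projCont]
  rw [← integral_finsetSum _ fun j _ => integrable_cont_mul _ φ]
  refine integral_congr_ae ?_
  have h1 : ∀ᵐ x, ∀ j, velocity (smoothing a) j x = smoothingCont (velocityOp j a) x :=
    ae_all_iff.mpr fun j => velocity_ae_eq j a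
  have h2 : ∀ᵐ x, ∀ j, partialDeriv j (smoothing b) x = gradCont j b x :=
    ae_all_iff.mpr fun j => partialDeriv_ae_eq j b
  filter_upwards [h1, h2] with x hx1 hx2
  simp only [advection, hx1, hx2, Finset.sum_mul, ContinuousMap.mul_apply]

/-- Integration of continuous functions as a continuous functional. -/
noncomputable def integralCont : C(Torus, ℂ) →L[ℂ] ℂ :=
  (innerSL ℂ (characterLp 0)).comp (ContinuousMap.toLp 2 (volume : Measure Torus) ℂ)

lemma integralCont_apply (f : C(Torus, ℂ)) : integralCont f = ∫ x, f x := by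
  rw [integralCont, ContinuousLinearMap.comp_apply, innerSL_apply_apply, inner_characterLp]
  refine integral_congr_ae ?_
  filter_upwards [ContinuousMap.coeFn_toLp (𝕜 := ℂ) (p := 2) (volume : Measure Torus) f] with x hx
  rw [hx, neg_zero, character_zero, ContinuousMap.one_apply, one_mul]

/-- The integral of a product of three Fourier series as a sum over resonant frequencies. -/
lemma hasSum_integral_mul_mul {f g h : (Fin 2 → ℤ) → ℂ} (hf : Summable fun k => ‖f k‖)
    (hg : Summable fun k => ‖g k‖) (hh : Summable fun k => ‖h k‖) :
    HasSum (fun z : ((Fin 2 → ℤ) × (Fin 2 → ℤ)) × (Fin 2 → ℤ) =>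
        f z.1.1 * g z.1.2 * h z.2 * ∫ x : Torus, character (z.1.1 + z.1.2 + z.2) x)
      (∫ x, fourierSeries f x * fourierSeries g x * fourierSeries h x) := by
  have sf := summable_norm_smul_character hf
  have sg := summable_norm_smul_character hg
  have sh := summable_norm_smul_character hh
  have sfg := sf.mul_norm sg
  have hs : HasSum (fun z : ((Fin 2 → ℤ) × (Fin 2 → ℤ)) × (Fin 2 → ℤ) =>
      f z.1.1 • character z.1.1 * g z.1.2 • character z.1.2 * h z.2 • character z.2)
      (fourierSeries f * fourierSeries g * fourierSeries h) := by
    rw [fourierSeries, fourierSeries, fourierSeries, tsum_mul_tsum_of_summable_norm sf sg,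
      tsum_mul_tsum_of_summable_norm sfg sh]
    exact (sfg.mul_norm sh).of_norm.hasSum
  have hs2 := hs.mapL integralCont
  rw [integralCont_apply] at hs2
  convert! hs2 using 2 with z
  rw [smul_mul_smul_comm, smul_mul_smul_comm, character_mul, character_mul, map_smul,
    integralCont_apply, smul_eq_mul]

lemma sum_velocitySymbol_mul (k : Fin 2 → ℤ) : ∑ j, velocitySymbol j k * (k j : ℂ) = 0 := by
  simp [velocitySymbol, Fin.sum_univ_two]
  ring

/-- The transport term is antisymmetric: the velocity field is divergence free, which means that
the Fourier coefficient of the velocity at `k` is orthogonal to `k`. -/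
lemma inner_advectionOp_antisymm (a b c : H) :
    inner ℝ (advectionOp a b) (smoothing c) = -inner ℝ (advectionOp a c) (smoothing b) := by
  let u (j : Fin 2) (k : Fin 2 → ℤ) : ℂ := smoothSymbol k * coeff (velocityOp j a) k
  let s (b : H) (k : Fin 2 → ℤ) : ℂ := smoothSymbol k * coeff b k
  let D (b : H) (j : Fin 2) (k : Fin 2 → ℤ) : ℂ := derivSymbol j k * smoothSymbol k * coeff b k
  have key (b c : H) : HasSum (fun z : ((Fin 2 → ℤ) × (Fin 2 → ℤ)) × (Fin 2 → ℤ) =>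
      ∑ j, u j z.1.1 * D b j z.1.2 * s c z.2 * ∫ x : Torus, character (z.1.1 + z.1.2 + z.2) x)
      ((inner ℝ (advectionOp a b) (smoothing c) : ℝ) : ℂ) := by
    rw [advectionOp_apply, sum_inner, Complex.ofReal_sum]
    refine hasSum_sum fun j _ => ?_
    rw [inner_projCont_smoothing, ← integral_complex_ofReal]
    simp only [ContinuousMap.mul_apply, Complex.ofReal_mul]
    have h1 (w : H) (x : Torus) : ((smoothingCont w x : ℝ) : ℂ) = fourierSeries (s w) x :=
      ofReal_fourierCont summable_smoothSymbol smoothSymbol_neg w x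
    have h2 (x : Torus) : ((gradCont j b x : ℝ) : ℂ) = fourierSeries (D b j) x :=
      ofReal_fourierCont (summable_derivSymbol j) (isSymbol_deriv j).neg b x
    simp only [h1, h2]
    exact hasSum_integral_mul_mul (summable_mul_coeff summable_smoothSymbol _).1
      (summable_mul_coeff (summable_derivSymbol j) _).1
      (summable_mul_coeff summable_smoothSymbol _).1
  let e : ((Fin 2 → ℤ) × (Fin 2 → ℤ)) × (Fin 2 → ℤ) ≃ ((Fin 2 → ℤ) × (Fin 2 → ℤ)) × (Fin 2 → ℤ) :=
    (Equiv.prodAssoc _ _ _).trans (((Equiv.refl _).prodCongr (Equiv.prodComm _ _)).trans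
      (Equiv.prodAssoc _ _ _).symm)
  have h1 := (key b c).add (e.hasSum_iff.mpr (key c b))
  have h2 : ((inner ℝ (advectionOp a b) (smoothing c) : ℝ) : ℂ) +
      ((inner ℝ (advectionOp a c) (smoothing b) : ℝ) : ℂ) = 0 := by
    refine h1.unique ?_
    convert! hasSum_zero using 2 with z
    obtain ⟨⟨p, q⟩, r⟩ := z
    change (∑ j, u j p * D b j q * s c r * ∫ x : Torus, character (p + q + r) x) +
      ∑ j, u j p * D c j r * s b q * ∫ x : Torus, character (p + r + q) x = 0
    rw [show p + r + q = p + q + r by abel, integral_character]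
    split_ifs with h
    · have hp : p = -(q + r) := by rw [eq_neg_iff_add_eq_zero, ← add_assoc, h]
      have hj (j : Fin 2) : (p j : ℂ) = -((q j : ℂ) + (r j : ℂ)) := by
        rw [hp]
        simp
      have h0 := sum_velocitySymbol_mul p
      rw [← Finset.sum_add_distrib]
      calc _ = ∑ j, velocitySymbol j p * (p j : ℂ) * (-Complex.I * smoothSymbol p * coeff a p *
            s b q * s c r * (4 * Real.pi ^ 2)) := by
            refine Finset.sum_congr rfl fun j _ => ?_
            rw [hj]
            simp only [u, D, s, coeff_velocityOp, derivSymbol]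
            ring
        _ = 0 := by rw [← Finset.sum_mul, h0, zero_mul]
    · simp
  rw [eq_neg_iff_add_eq_zero]
  exact_mod_cast h2

lemma inner_advectionOp_self (a b : H) : inner ℝ (advectionOp a b) (smoothing b) = 0 := by
  have := inner_advectionOp_antisymm a b b
  linarith

/-! ### Estimates of the nonlinear term -/

lemma norm_projCont_mul_le (f g : C(Torus, ℝ)) {w : H}
    (hw : (w : Lp ℝ 2 (volume : Measure Torus)) =ᵐ[volume] g) :
    ‖projCont (f * g)‖ ≤ ‖f‖ * ‖w‖ := by
  rw [projCont, ContinuousLinearMap.comp_apply]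
  refine (Submodule.norm_orthogonalProjectionOnto_apply_le _ _).trans ?_
  change _ ≤ ‖f‖ * ‖(w : Lp ℝ 2 (volume : Measure Torus))‖
  refine Lp.norm_le_mul_norm_of_ae_le_mul ?_
  filter_upwards [hw, ContinuousMap.coeFn_toLp (𝕜 := ℝ) (p := 2) (volume : Measure Torus) (f * g)]
    with x hx hx2
  rw [hx, hx2, ContinuousMap.mul_apply, norm_mul]
  gcongr
  exact f.norm_coe_le_norm x

/-- Two crude bounds of `B(𝒦u, v)`, used only where one of the arguments is a small perturbation:
the supremum of `∇v` is bounded by the norm of `v` in `H₃`, and that of `𝒦u` by the norm of `u` in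
`H₃`. -/
lemma exists_norm_advectionOp_le : ∃ C : ℝ, 0 ≤ C ∧ ∀ a b : H,
    ‖advectionOp a b‖ ≤ C * ‖smoothing a‖ * ‖b‖ ∧
      ‖advectionOp a b‖ ≤ C * ‖a‖ * √(dirichlet b) := by
  refine ⟨(∑ j, ‖gradCont j‖) + 2 * ‖smoothingCont‖, by positivity, fun a b => ⟨?_, ?_⟩⟩
  · rw [advectionOp_apply, mul_assoc, add_mul, Finset.sum_mul]
    refine le_add_of_le_of_nonneg ((norm_sum_le _ _).trans (Finset.sum_le_sum fun j _ => ?_))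
      (by positivity)
    rw [mul_comm (smoothingCont _)]
    refine (norm_projCont_mul_le _ _ (smoothing_ae_eq (velocityOp j a))).trans ?_
    rw [mul_comm ‖smoothing a‖, ← mul_assoc]
    gcongr
    · exact (gradCont j).le_opNorm b
    · rw [← velocityOp_smoothing]
      exact norm_fourierMul_le _ _
  · rw [advectionOp_apply, mul_assoc, add_mul]
    refine le_add_of_nonneg_of_le (by positivity) ?_
    have h (j : Fin 2) : ‖projCont (smoothingCont (velocityOp j a) * gradCont j b)‖ ≤
        ‖smoothingCont‖ * (‖a‖ * √(dirichlet b)) := by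
      refine (norm_projCont_mul_le _ _ (gradOp_ae_eq j b)).trans ?_
      rw [← mul_assoc]
      gcongr
      · refine (smoothingCont.le_opNorm _).trans ?_
        gcongr
        exact norm_fourierMul_le _ _
      · refine Real.le_sqrt_of_sq_le ?_
        exact Finset.single_le_sum (f := fun j => ‖gradOp j b‖ ^ 2) (fun _ _ => sq_nonneg _)
          (Finset.mem_univ j)
    refine (norm_sum_le _ _).trans ((Finset.sum_le_sum fun j _ => h j).trans_eq ?_)
    simp
    ring

lemma integral_mul_sq_le (f g : C(Torus, ℝ)) :
    (∫ x, f x * g x) ^ 2 ≤ (∫ x, f x ^ 2) * ∫ x, g x ^ 2 := by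
  have h (f g : C(Torus, ℝ)) : inner ℝ (ContinuousMap.toLp 2 (volume : Measure Torus) ℝ f)
      (ContinuousMap.toLp 2 (volume : Measure Torus) ℝ g) = ∫ x, f x * g x := by
    rw [ContinuousMap.inner_toLp]
    simp [mul_comm]
  have := real_inner_mul_inner_self_le (ContinuousMap.toLp 2 (volume : Measure Torus) ℝ f)
    (ContinuousMap.toLp 2 (volume : Measure Torus) ℝ g)
  simp only [h] at this
  simpa only [sq] using this

/-- Ladyzhenskaya's inequality as a bound of the integral of the fourth power. -/
lemma integral_pow_four_le {c₀ : ℝ} (hc : IsLadyzhenskayaConst c₀) (h0 : 0 ≤ c₀) (h : H) :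
    ∫ x, smoothingCont h x ^ 4 ≤ (c₀ * √(dirichlet h) * ‖smoothing h‖) ^ 2 := by
  have h1 := hc (smoothing h) (by rw [sobolevNorm_one_smoothing]; exact ENNReal.ofReal_lt_top)
  rw [sobolevNorm_one_smoothing, ← ENNReal.ofReal_mul h0, ← ENNReal.ofReal_mul (by positivity),
    eLpNorm_congr_ae (smoothing_ae_eq h), eLpNorm_eq_lintegral_rpow_enorm_toReal (by norm_num)
    (by norm_num)] at h1
  have h2 : ∫⁻ x, ‖smoothingCont h x‖ₑ ^ (4 : ℝ≥0∞).toReal =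
      ENNReal.ofReal (∫ x, smoothingCont h x ^ 4) := by
    rw [ofReal_integral_eq_lintegral_ofReal]
    · refine lintegral_congr fun x => ?_
      rw [← ofReal_norm, ENNReal.ofReal_rpow_of_nonneg (norm_nonneg _) (by norm_num)]
      congr 1
      norm_num
      exact (Even.pow_abs (by decide) _)
    · exact ((smoothingCont h).continuous.pow 4).integrable_of_hasCompactSupport
        (HasCompactSupport.of_compactSpace _)
    · exact ae_of_all _ fun x => by positivity
  rw [h2] at h1
  have hI : 0 ≤ ∫ x, smoothingCont h x ^ 4 := integral_nonneg fun x => by positivity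
  rw [ENNReal.ofReal_rpow_of_nonneg hI (by norm_num), ← ENNReal.ofReal_pow (by positivity),
    ENNReal.ofReal_le_ofReal_iff (by positivity), ← Real.rpow_natCast, ← Real.rpow_mul hI] at h1
  norm_num at h1
  rw [← Real.sqrt_eq_rpow, Real.sqrt_le_left (by positivity)] at h1
  exact h1

/-- The transport of `smoothing b` by the velocity field of a difference `smoothing a`, tested
against that difference. Ladyzhenskaya's inequality is applied to `smoothing a` and to the components of its
velocity field, whose norms in `H₁` add up in squares to at most `‖smoothing a‖²`. -/
lemma abs_inner_advectionOp_le {c₀ : ℝ} (hc : IsLadyzhenskayaConst c₀) (h0 : 0 ≤ c₀) (a b : H) :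
    |inner ℝ (advectionOp a b) (smoothing a)| ≤
      c₀ * ‖smoothing a‖ * √(dirichlet b) * √(dirichlet a) := by
  have hD (j : Fin 2) : ∫ x, gradCont j b x ^ 2 = ‖gradOp j b‖ ^ 2 := by
    rw [← real_inner_self_eq_norm_sq, Submodule.coe_inner, L2.inner_def]
    refine integral_congr_ae ?_
    filter_upwards [gradOp_ae_eq j b] with x hx
    rw [hx]
    simp [sq]
  set P := √(dirichlet a) with hP
  have hPa : ‖smoothing a‖ ≤ P := Real.le_sqrt_of_sq_le (norm_smoothing_sq_le a)
  -- The product of the velocity and the vorticity in `L²`, by Hölder's inequality.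
  have hU (j : Fin 2) : ∫ x, (smoothingCont (velocityOp j a) x * smoothingCont a x) ^ 2 ≤
      c₀ ^ 2 * dirichlet (velocityOp j a) * P ^ 2 := by
    have h1 := integral_mul_sq_le (smoothingCont (velocityOp j a) ^ 2) (smoothingCont a ^ 2)
    simp only [ContinuousMap.pow_apply, ← pow_mul] at h1
    have h2 := integral_pow_four_le hc h0 (velocityOp j a)
    have h3 := integral_pow_four_le hc h0 a
    set Q := √(dirichlet (velocityOp j a)) with hQ
    have hQ2 : dirichlet (velocityOp j a) = Q ^ 2 := (Real.sq_sqrt (dirichlet_nonneg _)).symm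
    have hQa : ‖smoothing (velocityOp j a)‖ ≤ Q := Real.le_sqrt_of_sq_le (norm_smoothing_sq_le _)
    have hQ0 : 0 ≤ Q := Real.sqrt_nonneg _
    have hP0 : 0 ≤ P := Real.sqrt_nonneg _
    have h4 : ∫ x, smoothingCont (velocityOp j a) x ^ 4 ≤ (c₀ * Q ^ 2) ^ 2 := by
      refine h2.trans (pow_le_pow_left₀ (by positivity) ?_ 2)
      rw [mul_assoc, sq]
      gcongr
    have h5 : ∫ x, smoothingCont a x ^ 4 ≤ (c₀ * P ^ 2) ^ 2 := by
      refine h3.trans (pow_le_pow_left₀ (by positivity) ?_ 2)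
      rw [mul_assoc, sq]
      gcongr
    rw [hQ2]
    simp only [mul_pow]
    refine (abs_le_of_sq_le_sq' (b := c₀ ^ 2 * Q ^ 2 * P ^ 2) ?_ (by positivity)).2
    refine h1.trans ?_
    calc _ ≤ (c₀ * Q ^ 2) ^ 2 * (c₀ * P ^ 2) ^ 2 := by
          gcongr
          exact integral_nonneg fun x => Even.pow_nonneg (by decide) _
      _ = _ := by ring
  have hI (j : Fin 2) : (∫ x, smoothingCont (velocityOp j a) x * gradCont j b x *
      smoothingCont a x) ^ 2 ≤ c₀ ^ 2 * dirichlet (velocityOp j a) * P ^ 2 * ‖gradOp j b‖ ^ 2 := by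
    have h1 := integral_mul_sq_le (smoothingCont (velocityOp j a) * smoothingCont a) (gradCont j b)
    rw [hD] at h1
    refine le_trans (le_of_eq ?_) (h1.trans (mul_le_mul_of_nonneg_right (hU j) (by positivity)))
    congr 2
    ext x
    simp
    ring
  rw [advectionOp_apply, sum_inner]
  simp only [inner_projCont_smoothing, ContinuousMap.mul_apply]
  refine abs_le_of_sq_le_sq ?_ (by positivity)
  have hsum := sum_dirichlet_velocityOp_le a
  calc (∑ j, ∫ x, smoothingCont (velocityOp j a) x * gradCont j b x * smoothingCont a x) ^ 2
      ≤ (∑ j, c₀ ^ 2 * dirichlet (velocityOp j a) * P ^ 2) * ∑ j, ‖gradOp j b‖ ^ 2 := by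
        refine Finset.sum_sq_le_sum_mul_sum_of_sq_le_mul _ (fun j _ => ?_) (fun j _ => ?_)
          fun j _ => hI j
        · have := dirichlet_nonneg (velocityOp j a)
          positivity
        · positivity
    _ ≤ (c₀ ^ 2 * ‖smoothing a‖ ^ 2 * P ^ 2) * dirichlet b := by
        rw [← Finset.sum_mul, ← Finset.mul_sum]
        refine mul_le_mul_of_nonneg_right ?_ (dirichlet_nonneg b)
        gcongr
    _ = (c₀ * ‖smoothing a‖ * √(dirichlet b) * P) ^ 2 := by
        rw [mul_pow, mul_pow, mul_pow, Real.sq_sqrt (dirichlet_nonneg b)]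
        ring

/-! ### Small balls of Brownian motion -/

/-- The paths which are bounded by `δ` at the times before `T` of a fixed dense sequence. -/
def smallPaths (T : ℝ≥0) (δ : ℝ) : Set (ℝ≥0 → ℝ) :=
  {x | ∀ n, TopologicalSpace.denseSeq ℝ≥0 n < T → |x (TopologicalSpace.denseSeq ℝ≥0 n)| ≤ δ}

lemma measurableSet_smallPaths (T : ℝ≥0) (δ : ℝ) : MeasurableSet (smallPaths T δ) := by
  rw [smallPaths]
  simp only [ofPred_forall]
  refine MeasurableSet.iInter fun n => MeasurableSet.iInter fun _ => ?_
  exact measurableSet_le (by fun_prop) measurable_const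

lemma abs_le_of_mem_smallPaths {T : ℝ≥0} {δ : ℝ} {x : ℝ≥0 → ℝ} (hx : x ∈ smallPaths T δ)
    (hc : Continuous x) {t : ℝ≥0} (ht : t < T) : |x t| ≤ δ := by
  have h1 : t ∈ closure (Iio T ∩ range (TopologicalSpace.denseSeq ℝ≥0)) :=
    (TopologicalSpace.denseRange_denseSeq ℝ≥0).open_subset_closure_inter isOpen_Iio ht
  have h2 : IsClosed {t | |x t| ≤ δ} := isClosed_le (by fun_prop) continuous_const
  refine closure_minimal ?_ h2 h1
  rintro _ ⟨hn, n, rfl⟩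
  exact hx n hn

section SmallBall

variable {Ω : Type*} [MeasurableSpace Ω] {P : Measure Ω} {X : ℝ≥0 → Ω → ℝ}

lemma isProjectiveLimit_map (hm : ∀ t, Measurable (X t)) (hX : IsPreBrownianReal X P) :
    IsProjectiveLimit (P.map fun ω t => X t ω) BrownianReal.projectiveFamily := by
  intro I
  rw [Measure.map_map (by fun_prop) (by fun_prop)]
  exact (hX.hasLaw I).map_eq

/-- The difference of two independent copies of a Brownian motion, divided by `√2`, is a Brownian
motion. -/
lemma isPreBrownianReal_symmetrization [IsProbabilityMeasure P] (hm : ∀ t, Measurable (X t))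
    (hX : IsPreBrownianReal X P) :
    IsPreBrownianReal (fun t (z : Ω × Ω) => (√2)⁻¹ * (X t z.1 - X t z.2)) (P.prod P) := by
  have hfst : IsPreBrownianReal (fun t (z : Ω × Ω) => X t z.1) (P.prod P) :=
    ⟨fun I => (hX.hasLaw I).comp measurePreserving_fst.hasLaw⟩
  have hsnd : IsPreBrownianReal (fun t (z : Ω × Ω) => X t z.2) (P.prod P) :=
    ⟨fun I => (hX.hasLaw I).comp measurePreserving_snd.hasLaw⟩
  have hcross (s t : ℝ≥0) : cov[fun z : Ω × Ω => X s z.1, fun z => X t z.2; P.prod P] = 0 :=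
    (indepFun_prod (hm s) (hm t)).covariance_eq_zero
      (hfst.isGaussianProcess.hasGaussianLaw_eval s).memLp_two
      (hsnd.isGaussianProcess.hasGaussianLaw_eval t).memLp_two
  have hsub : IsGaussianProcess (fun t (z : Ω × Ω) => X t z.1 - X t z.2) (P.prod P) := by
    refine ⟨fun I => ?_⟩
    exact iIndepFun.hasGaussianLaw_fun_sub (hfst.isGaussianProcess.hasGaussianLaw I)
      (hsnd.isGaussianProcess.hasGaussianLaw I)
      (indepFun_prod (X := fun ω => I.restrict (X · ω)) (Y := fun ω => I.restrict (X · ω))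
        (by fun_prop) (by fun_prop))
  refine (hsub.smul fun _ => (√2)⁻¹).isPreBrownianReal_of_covariance (fun t => ?_)
    fun s t hst => ?_
  · simp only [smul_eq_mul]
    rw [integral_const_mul, integral_sub (hfst.integrable_eval t) (hsnd.integrable_eval t),
      hfst.integral_eval, hsnd.integral_eval, sub_zero, mul_zero]
  · have m1 (t) := (hfst.isGaussianProcess.hasGaussianLaw_eval t).memLp_two
    have m2 (t) := (hsnd.isGaussianProcess.hasGaussianLaw_eval t).memLp_two
    have m3 : MemLp (fun z : Ω × Ω => X t z.1 - X t z.2) 2 (P.prod P) := (m1 t).sub (m2 t)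
    simp only [smul_eq_mul]
    rw [covariance_const_mul_left, covariance_const_mul_right,
      covariance_fun_sub_left (m1 s) (m2 s) m3, covariance_fun_sub_right (m1 s) (m1 t) (m2 t),
      covariance_fun_sub_right (m2 s) (m1 t) (m2 t),
      hfst.covariance_eval, hsnd.covariance_eval, hcross, covariance_comm, hcross, min_eq_left hst]
    have : (√2)⁻¹ * ((√2)⁻¹ * 2) = (1 : ℝ) := by
      rw [← mul_assoc, ← mul_inv, Real.mul_self_sqrt zero_le_two, inv_mul_cancel₀ two_ne_zero]
    linear_combination (s : ℝ) * this

/-- Brownian motion stays in every ball around the origin with positive probability: by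
separability of the space of paths some ball has positive probability, and the symmetrization of
a Brownian motion which is in this ball is close to the origin. -/
lemma measure_smallPaths_pos (hm : ∀ t, Measurable (X t)) (hX : IsBrownianReal X P)
    (T : ℝ≥0) {δ : ℝ} (hδ : 0 < δ) : 0 < P {ω | (fun t => X t ω) ∈ smallPaths T δ} := by
  have hP : IsProbabilityMeasure P := hX.isGaussianProcess.isProbabilityMeasure
  have hXm : Measurable fun ω t => X t ω := measurable_pi_lambda _ hm
  let c := TopologicalSpace.denseSeq C(Icc 0 T, ℝ)
  let A (n : ℕ) : Set Ω := {ω | ∀ m, ∀ h : TopologicalSpace.denseSeq ℝ≥0 m < T,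
    |X (TopologicalSpace.denseSeq ℝ≥0 m) ω - c n ⟨_, zero_le, h.le⟩| ≤ δ / 2}
  have hcover : ∀ᵐ ω ∂P, ω ∈ ⋃ n, A n := by
    filter_upwards [hX.cont] with ω hω
    let f : C(Icc 0 T, ℝ) := ⟨fun t => X t ω, hω.comp continuous_subtype_val⟩
    obtain ⟨n, hn⟩ := (TopologicalSpace.denseRange_denseSeq C(Icc 0 T, ℝ)).exists_dist_lt f
      (half_pos hδ)
    refine mem_iUnion.mpr ⟨n, fun m h => ?_⟩
    rw [← Real.dist_eq]
    exact (ContinuousMap.dist_apply_le_dist (f := f) (g := c n) ⟨_, zero_le, h.le⟩).trans hn.le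
  obtain ⟨n, hn⟩ : ∃ n, 0 < P (A n) := by
    by_contra! h
    have h0 : P (⋃ n, A n) = 0 := measure_iUnion_null fun n => le_antisymm (h n) zero_le
    have h1 : P univ ≤ P (⋃ n, A n) := measure_mono_ae (hcover.mono fun ω h _ => h)
    rw [h0, measure_univ] at h1
    exact not_lt_of_ge h1 one_pos
  have hm2 (t) : Measurable fun z : Ω × Ω => (√2)⁻¹ * (X t z.1 - X t z.2) := by
    have := hm t
    fun_prop
  have hlaw : P.map (fun ω t => X t ω) =
      (P.prod P).map (fun z t => (√2)⁻¹ * (X t z.1 - X t z.2)) :=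
    (isProjectiveLimit_map hm hX.toIsPreBrownianReal).unique
      (isProjectiveLimit_map hm2 (isPreBrownianReal_symmetrization hm hX.toIsPreBrownianReal))
  have hset : P {ω | (fun t => X t ω) ∈ smallPaths T δ} =
      (P.prod P) {z | (fun t => (√2)⁻¹ * (X t z.1 - X t z.2)) ∈ smallPaths T δ} := by
    have h := DFunLike.congr_fun hlaw (smallPaths T δ)
    rwa [Measure.map_apply hXm (measurableSet_smallPaths T δ),
      Measure.map_apply (measurable_pi_lambda _ hm2) (measurableSet_smallPaths T δ)] at h
  rw [hset]
  refine lt_of_lt_of_le ?_ (measure_mono (s := A n ×ˢ A n) ?_)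
  · rw [Measure.prod_prod]
    exact ENNReal.mul_pos hn.ne' hn.ne'
  · rintro ⟨ω, ω'⟩ ⟨h1, h2⟩ m hm
    have h3 := h1 m hm
    have h4 := h2 m hm
    have h5 : |X (TopologicalSpace.denseSeq ℝ≥0 m) ω - X (TopologicalSpace.denseSeq ℝ≥0 m) ω'|
        ≤ δ := by
      rw [abs_le] at *
      constructor <;> linarith [h3.1, h3.2, h4.1, h4.2]
    have h6 : (√2)⁻¹ ≤ (1 : ℝ) := inv_le_one_of_one_le₀ (Real.one_le_sqrt.mpr one_le_two)
    change |(√2)⁻¹ * (_ - _)| ≤ δ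
    rw [abs_mul, abs_of_nonneg (by positivity)]
    exact (mul_le_of_le_one_left (abs_nonneg _) h6).trans h5

end SmallBall

/-- The probability of a small ball is the same for all Brownian motions. -/
lemma exists_le_measure_smallPaths (T : ℝ≥0) {δ : ℝ} (hδ : 0 < δ) : ∃ p : ℝ≥0∞, 0 < p ∧
    ∀ (Ω : Type) (_ : MeasurableSpace Ω) (P : Measure Ω) (X : ℝ≥0 → Ω → ℝ),
      (∀ t, Measurable (X t)) → IsBrownianReal X P →
        p ≤ P {ω | (fun t => X t ω) ∈ smallPaths T δ} := by
  by_cases h : ∃ (Ω : Type) (_ : MeasurableSpace Ω) (P : Measure Ω) (X : ℝ≥0 → Ω → ℝ),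
      (∀ t, Measurable (X t)) ∧ IsBrownianReal X P
  · obtain ⟨Ω₀, _, P₀, X₀, hm₀, hX₀⟩ := h
    refine ⟨_, measure_smallPaths_pos hm₀ hX₀ T hδ, fun Ω _ P X hm hX => le_of_eq ?_⟩
    have hlaw := (isProjectiveLimit_map hm₀ hX₀.toIsPreBrownianReal).unique
      (isProjectiveLimit_map hm hX.toIsPreBrownianReal)
    have h := DFunLike.congr_fun hlaw (smallPaths T δ)
    rwa [Measure.map_apply (measurable_pi_lambda _ hm₀) (measurableSet_smallPaths T δ),
      Measure.map_apply (measurable_pi_lambda _ hm) (measurableSet_smallPaths T δ)] at h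
  · exact ⟨1, one_pos, fun Ω _ P X hm hX => absurd ⟨Ω, _, P, X, hm, hX⟩ h⟩

/-- The increments over a time interval of given length of a two-sided Brownian motion are small
with a probability that is bounded below, uniformly in the position of the interval. -/
lemma exists_small_noise {T δ : ℝ} (hT : 0 ≤ T) (hδ : 0 < δ) (d : ℕ) : ∃ p : ℝ≥0∞, 0 < p ∧
    ∀ (Ω : Type) (_ : MeasurableSpace Ω) (P : Measure Ω) (W : ℝ → Ω → Fin d → ℝ),
      IsProbabilityMeasure P → IsTwoSidedBrownian W P → ∀ s : ℝ,
      ∃ E : Set Ω, p ≤ P E ∧ ∀ ω ∈ E, (Continuous fun t => W t ω) ∧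
        ∀ t ∈ Icc s (s + T), ∀ i, |W t ω i - W s ω i| ≤ δ := by
  obtain ⟨p, hp, hball⟩ := exists_le_measure_smallPaths (T + 1).toNNReal (half_pos hδ)
  refine ⟨p ^ Fintype.card (Fin d × Bool), ENNReal.pow_pos hp _, ?_⟩
  intro Ω _ P W hP hW s
  -- The interval is covered by an interval of length `T` on each side of the origin.
  let a (b : Bool) : ℝ≥0 := if b then s.toNNReal else (-s - T).toNNReal
  let Z (q : Fin d × Bool) (t : ℝ≥0) (ω : Ω) : ℝ := W (if q.2 then (t : ℝ) else -(t : ℝ)) ω q.1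
  have hZ (q : Fin d × Bool) : IsBrownianReal (Z q) P := by
    obtain ⟨i, b⟩ := q
    cases b
    · exact hW.backward i
    · exact hW.forward i
  have hZm (q : Fin d × Bool) (t : ℝ≥0) : Measurable (Z q t) :=
    (measurable_pi_apply q.1).comp (hW.measurable _)
  let S (q : Fin d × Bool) (x : ℝ≥0 → ℝ) (t : ℝ≥0) : ℝ := x (a q.2 + t) - x (a q.2)
  have hSm (q : Fin d × Bool) : Measurable (S q) := by
    refine measurable_pi_lambda _ fun t => ?_
    fun_prop
  let E₀ : Set Ω := ⋂ q, {ω | S q (fun t => Z q t ω) ∈ smallPaths (T + 1).toNNReal (δ / 2)}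
  have hE₀ : p ^ Fintype.card (Fin d × Bool) ≤ P E₀ := by
    have hind := hW.indep.comp S hSm
    have h := hind.measure_inter_preimage_eq_mul Finset.univ
      (sets := fun _ => smallPaths (T + 1).toNNReal (δ / 2))
      (fun _ _ => measurableSet_smallPaths _ _)
    simp only [Finset.mem_univ, iInter_true] at h
    refine le_trans ?_ (h.symm.le)
    rw [Fintype.card, ← Finset.prod_const]
    refine Finset.prod_le_prod' fun q _ => ?_
    refine hball Ω _ P (fun t ω => S q (fun t => Z q t ω) t) (fun t => ?_) ((hZ q).shift (a q.2))
    exact (hZm q _).sub (hZm q _)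
  have hcont : ∀ᵐ ω ∂P, ∀ q, Continuous fun t => Z q t ω := ae_all_iff.mpr fun q => (hZ q).cont
  refine ⟨E₀ ∩ {ω | ∀ q, Continuous fun t => Z q t ω}, ?_, ?_⟩
  · rwa [measure_inter_conull hcont]
  rintro ω ⟨hω, hc⟩
  have hmem (i : Fin d) (b : Bool) {t : ℝ≥0} (ht : (t : ℝ) ≤ T) :
      |Z (i, b) (a b + t) ω - Z (i, b) (a b) ω| ≤ δ / 2 := by
    refine abs_le_of_mem_smallPaths (mem_iInter.mp hω (i, b)) ?_ ?_
    · have := hc (i, b)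
      fun_prop
    · rw [Real.lt_toNNReal_iff_coe_lt]
      exact lt_of_le_of_lt ht (lt_add_one T)
  have hfw (i : Fin d) {u : ℝ} (hu : 0 ≤ u) (huT : u ≤ T) :
      |W (max s 0 + u) ω i - W (max s 0) ω i| ≤ δ / 2 := by
    have h := hmem i true (t := u.toNNReal) (by rwa [Real.coe_toNNReal _ hu])
    simpa [Z, a, Real.coe_toNNReal', max_eq_left hu] using h
  have hbw (i : Fin d) {u : ℝ} (hu : 0 ≤ u) (huT : u ≤ T) :
      |W (-(max (-s - T) 0 + u)) ω i - W (-max (-s - T) 0) ω i| ≤ δ / 2 := by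
    have h := hmem i false (t := u.toNNReal) (by rwa [Real.coe_toNNReal _ hu])
    simpa only [Z, a, Bool.false_eq_true, if_false, NNReal.coe_add, Real.coe_toNNReal',
      max_eq_left hu] using h
  refine ⟨continuous_pi fun i => ?_, fun t ht i => ?_⟩
  · have h : (fun t => W t ω i) = fun t : ℝ =>
        Z (i, true) t.toNNReal ω + Z (i, false) (-t).toNNReal ω - W 0 ω i := by
      funext t
      rcases le_total 0 t with h | h
      · simp [Z, Real.coe_toNNReal', h]
      · simp [Z, Real.coe_toNNReal', h]
    rw [h]
    have h1 := hc (i, true)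
    have h2 := hc (i, false)
    fun_prop
  · rcases le_total 0 s with h0 | h0
    · have h := hfw i (u := t - s) (by linarith [ht.1]) (by linarith [ht.2])
      rw [max_eq_left h0, add_sub_cancel] at h
      linarith
    rcases le_total (s + T) 0 with h1 | h1
    · have h2 := hbw i (u := s + T - t) (by linarith [ht.2]) (by linarith [ht.1])
      have h3 := hbw i (u := T) hT le_rfl
      rw [max_eq_left (by linarith)] at h2 h3
      rw [show -(-s - T + (s + T - t)) = t by ring] at h2
      rw [show -(-s - T + T) = s by ring] at h3
      rw [abs_le] at *
      constructor <;> linarith [h2.1, h2.2, h3.1, h3.2]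
    · have h3 := hbw i (u := -s) (by linarith) (by linarith)
      rw [max_eq_right (by linarith), zero_add, neg_neg, neg_zero] at h3
      have h2 : |W t ω i - W 0 ω i| ≤ δ / 2 := by
        rcases le_total 0 t with h4 | h4
        · have h := hfw i (u := t) h4 (by linarith [ht.2])
          rwa [max_eq_right h0, zero_add] at h
        · have h := hbw i (u := -t) (by linarith) (by linarith [ht.1])
          rwa [max_eq_right (by linarith), zero_add, neg_neg, neg_zero] at h
      rw [abs_le] at *
      constructor <;> linarith [h2.1, h2.2, h3.1, h3.2]

/-! ### Energy estimates -/

-- Unfolding the multiplier operators only slows down unification from here on.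
attribute [local irreducible] smoothing gradOp laplacianOp velocityOp smoothingCont gradCont
  advectionOp dirichlet

/-- The right-hand side `ν Δw - B(𝒦w, w) + f` of the unforced equation for `w = smoothing h`. -/
noncomputable def drift (ν : ℝ) (f h : H) : H := ν • laplacianOp h - advectionOp h h + f

lemma inner_drift (ν : ℝ) (f h x : H) : inner ℝ (drift ν f h) x =
    ν * inner ℝ (laplacianOp h) x - inner ℝ (advectionOp h h) x + inner ℝ f x := by
  rw [drift, inner_add_left, inner_sub_left]
  have h1 : inner ℝ (ν • laplacianOp h) x = ν * inner ℝ (laplacianOp h) x :=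
    real_inner_smul_left (F := H) _ _ _
  rw [h1]

lemma inner_advectionOp_add_left (a a' b x : H) : inner ℝ (advectionOp (a + a') b) x =
    inner ℝ (advectionOp a b) x + inner ℝ (advectionOp a' b) x := by
  rw [map_add, add_apply, inner_add_left]

lemma inner_advectionOp_add_right (a b b' x : H) : inner ℝ (advectionOp a (b + b')) x =
    inner ℝ (advectionOp a b) x + inner ℝ (advectionOp a b') x := by
  rw [map_add, inner_add_left]

lemma inner_laplacianOp_add_le (c ξ : H) : inner ℝ (laplacianOp (c + ξ)) (smoothing c) ≤
    -dirichlet c + ‖ξ‖ * ‖smoothing c‖ := by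
  rw [map_add, inner_add_left, inner_laplacianOp]
  gcongr
  refine (real_inner_le_norm _ _).trans ?_
  gcongr
  exact norm_laplacianOp_le ξ

/-- The energy inequality of a perturbed solution. The term `B(𝒦w, w)` of `w = smoothing (h + e)` is
tested against `w - smoothing e`, so that only its part containing `e` survives. -/
lemma energy_le {ν δ M C : ℝ} (hν : 0 < ν) (hδ : 0 ≤ δ) (hδ1 : δ ≤ 1) (hC : 0 ≤ C)
    (hadv : ∀ a b : H, ‖advectionOp a b‖ ≤ C * ‖smoothing a‖ * ‖b‖)
    {f h e : H} (he : ‖e‖ ≤ δ) (hf : ‖f‖ ≤ M) :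
    2 * inner ℝ (smoothing h) (drift ν f (h + e)) ≤
      -(ν - δ * (ν + 3 * C)) * dirichlet h + (M ^ 2 / ν + δ * (ν + 3 * C)) := by
  have hV := norm_smoothing_sq_le h
  have hV0 : 0 ≤ ‖smoothing h‖ := norm_nonneg _
  have h1 := inner_laplacianOp_add_le h e
  have h1' : ‖e‖ * ‖smoothing h‖ ≤ δ * ‖smoothing h‖ := by gcongr
  have h2 : -inner ℝ (advectionOp (h + e) (h + e)) (smoothing h) ≤
      C * (‖smoothing h‖ + δ) * δ * ‖smoothing h‖ := by
    obtain ⟨w, hw⟩ : ∃ w, w = h + e := ⟨_, rfl⟩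
    have hw1 := inner_advectionOp_add_right w h e (smoothing h)
    rw [inner_advectionOp_self, zero_add, ← hw] at hw1
    have hw2 : ‖smoothing w‖ ≤ ‖smoothing h‖ + δ := by
      rw [hw, map_add]
      exact (norm_add_le _ _).trans (add_le_add le_rfl ((norm_smoothing_le e).trans he))
    rw [← hw, hw1]
    refine (neg_le_abs _).trans ((abs_real_inner_le_norm _ _).trans ?_)
    refine mul_le_mul_of_nonneg_right ((hadv _ _).trans ?_) hV0
    gcongr
  have h3 : inner ℝ f (smoothing h) ≤ M * ‖smoothing h‖ :=
    (real_inner_le_norm _ _).trans (mul_le_mul_of_nonneg_right hf hV0)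
  rw [real_inner_comm, inner_drift]
  generalize inner ℝ (laplacianOp (h + e)) (smoothing h) = A at *
  generalize inner ℝ (advectionOp (h + e) (h + e)) (smoothing h) = B at *
  generalize inner ℝ f (smoothing h) = F at *
  generalize ‖smoothing h‖ = V at *
  generalize dirichlet h = q at *
  have h4 : 2 * (M * V) ≤ ν * V ^ 2 + M ^ 2 / ν := by
    have : 0 ≤ (ν * V - M) ^ 2 / ν := by positivity
    have h5 : (ν * V - M) ^ 2 / ν = ν * V ^ 2 + M ^ 2 / ν - 2 * (M * V) := by
      field_simp
      ring
    linarith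
  have h6 : ν * A ≤ ν * (-q + δ * V) := by
    gcongr
    linarith
  have h7 : 2 * (δ * V) ≤ δ * (1 + V ^ 2) := by nlinarith [sq_nonneg (V - 1)]
  have h8 : 2 * (C * (V + δ) * δ * V) ≤ δ * C * (1 + 3 * V ^ 2) := by
    have : 2 * ((V + δ) * V) ≤ 1 + 3 * V ^ 2 := by nlinarith [sq_nonneg (V - 1)]
    have := mul_le_mul_of_nonneg_left this (mul_nonneg hδ hC)
    linarith
  have h9 : ν * (2 * (δ * V)) ≤ ν * (δ * (1 + V ^ 2)) := by gcongr
  have h10 : ν * V ^ 2 ≤ ν * q := by gcongr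
  have h11 : δ * (ν + 3 * C) * V ^ 2 ≤ δ * (ν + 3 * C) * q := by gcongr
  have h12 : 0 ≤ δ * C := mul_nonneg hδ hC
  linarith

/-- The elementary inequalities behind `difference_le`. -/
lemma difference_arith {ν δ c₀ ρ C Z P Q X L L₂ F a₁ a₂ a₃ a₄ a₅ a₆ : ℝ} (hν : 0 < ν) (hδ : 0 ≤ δ)
    (hC : 0 ≤ C) (hρ : 0 ≤ ρ) (hZ0 : 0 ≤ Z) (hQ0 : 0 ≤ Q) (hZρ : Z ≤ 2 * ρ) (hZP : Z ≤ P)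
    (B0 : X ≤ 2 * δ * (2 * ρ)) (A0 : L ≤ -P ^ 2 + X) (A1 : -a₁ ≤ c₀ * Z * Q * P)
    (A2 : -a₂ ≤ C * (2 * ρ) * δ * Z) (A3 : -a₃ ≤ C * (2 * δ) * Q * Z)
    (A4 : -a₄ ≤ C * (2 * δ) * 1 * Z) (A6 : -a₆ ≤ C * (ρ + 1) * (2 * δ) * Z) :
    2 * (ν * (L₂ + L) - (a₅ + (0 + a₆) + (a₁ + a₂ + (a₃ + a₄))) + F - (ν * L₂ - a₅ + F)) ≤
      -ν * Z ^ 2 + c₀ ^ 2 / ν * Q ^ 2 * Z ^ 2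
        + δ * (8 * ν * ρ + 16 * C * ρ ^ 2 + 24 * C * ρ) * (1 + Q ^ 2) := by
  have B2 : C * (2 * ρ) * δ * Z ≤ C * (2 * ρ) * δ * (2 * ρ) := by gcongr
  have B3 : C * (2 * δ) * Q * Z ≤ C * (2 * δ) * Q * (2 * ρ) := by gcongr
  have B3' : C * (2 * δ) * (2 * ρ) * Q ≤ C * (2 * δ) * (2 * ρ) * (1 + Q ^ 2) := by
    gcongr
    nlinarith [sq_nonneg (Q - 1)]
  have B4 : C * (2 * δ) * 1 * Z ≤ C * (2 * δ) * 1 * (2 * ρ) := by gcongr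
  have B6 : C * (ρ + 1) * (2 * δ) * Z ≤ C * (ρ + 1) * (2 * δ) * (2 * ρ) := by gcongr
  have B1 : 2 * (c₀ * Z * Q * P) ≤ ν * P ^ 2 + c₀ ^ 2 / ν * Q ^ 2 * Z ^ 2 := by
    have h5 : (ν * P - c₀ * Z * Q) ^ 2 / ν =
        ν * P ^ 2 + c₀ ^ 2 / ν * Q ^ 2 * Z ^ 2 - 2 * (c₀ * Z * Q * P) := by
      field_simp
      ring
    have : 0 ≤ (ν * P - c₀ * Z * Q) ^ 2 / ν := by positivity
    linarith
  have hZP2 : ν * Z ^ 2 ≤ ν * P ^ 2 := by gcongr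
  have A0' := mul_le_mul_of_nonneg_left (A0.trans (add_le_add_right B0 _)) hν.le
  have hrest : 0 ≤ δ * (8 * ν * ρ + 16 * C * ρ ^ 2 + 16 * C * ρ) * Q ^ 2 := by positivity
  linarith

set_option maxHeartbeats 1000000 in
/-- The energy inequality for the difference `z` of two perturbed solutions. Of the
difference of the nonlinear terms, only the transport of the first solution by `𝒦z` survives
without a perturbation; it is estimated by Ladyzhenskaya's inequality and absorbed in the
dissipation. -/
lemma difference_le {ν δ c₀ ρ C : ℝ} (hν : 0 < ν) (hδ : 0 ≤ δ) (hδ1 : δ ≤ 1) (hC : 0 ≤ C)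
    (hρ : 0 ≤ ρ) (hc : IsLadyzhenskayaConst c₀) (hc0 : 0 ≤ c₀)
    (hadv : ∀ a b : H, ‖advectionOp a b‖ ≤ C * ‖smoothing a‖ * ‖b‖ ∧
      ‖advectionOp a b‖ ≤ C * ‖a‖ * √(dirichlet b))
    {f h₁ h₂ e₁ e₂ : H} (he₁ : ‖e₁‖ ≤ δ) (he₂ : ‖e₂‖ ≤ δ) (hh₁ : ‖smoothing h₁‖ ≤ ρ)
    (hh₂ : ‖smoothing h₂‖ ≤ ρ) :
    2 * inner ℝ (smoothing h₁ - smoothing h₂) (drift ν f (h₁ + e₁) - drift ν f (h₂ + e₂)) ≤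
      -ν * ‖smoothing h₁ - smoothing h₂‖ ^ 2
        + c₀ ^ 2 / ν * dirichlet h₁ * ‖smoothing h₁ - smoothing h₂‖ ^ 2
        + δ * (8 * ν * ρ + 16 * C * ρ ^ 2 + 24 * C * ρ) * (1 + dirichlet h₁) := by
  have hZρ : ‖smoothing h₁ - smoothing h₂‖ ≤ 2 * ρ := (norm_sub_le _ _).trans (by linarith)
  obtain ⟨c, hcdef⟩ : ∃ c, c = h₁ - h₂ := ⟨_, rfl⟩
  obtain ⟨ξ, hξdef⟩ : ∃ ξ, ξ = e₁ - e₂ := ⟨_, rfl⟩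
  have hξ : ‖ξ‖ ≤ 2 * δ := by rw [hξdef]; exact (norm_sub_le _ _).trans (by linarith)
  have hsm : smoothing h₁ - smoothing h₂ = smoothing c := by rw [hcdef, map_sub]
  rw [hsm] at hZρ ⊢
  have hcξ : h₁ + e₁ = (h₂ + e₂) + (c + ξ) := by rw [hcdef, hξdef]; abel
  obtain ⟨w₁, hw₁⟩ : ∃ w₁, w₁ = h₁ + e₁ := ⟨_, rfl⟩
  obtain ⟨w₂, hw₂⟩ : ∃ w₂, w₂ = h₂ + e₂ := ⟨_, rfl⟩
  obtain ⟨x, hx⟩ : ∃ x, x = c + ξ := ⟨_, rfl⟩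
  rw [← hw₁, ← hw₂, ← hx] at hcξ
  have hw₂ρ : ‖smoothing w₂‖ ≤ ρ + 1 := by
    rw [hw₂, map_add]
    exact (norm_add_le _ _).trans (add_le_add hh₂ ((norm_smoothing_le e₂).trans (he₂.trans hδ1)))
  have hlap : inner ℝ (laplacianOp w₁) (smoothing c) =
      inner ℝ (laplacianOp w₂) (smoothing c) + inner ℝ (laplacianOp x) (smoothing c) := by
    rw [hcξ, map_add, inner_add_left]
  have hadv1 := inner_advectionOp_add_left w₂ x w₁ (smoothing c)
  have hadv2 := inner_advectionOp_add_right w₂ w₂ x (smoothing c)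
  rw [← hcξ] at hadv1 hadv2
  have hadv3 := inner_advectionOp_add_left c ξ w₁ (smoothing c)
  rw [← hx] at hadv3
  have hadv4 := inner_advectionOp_add_right w₂ c ξ (smoothing c)
  rw [← hx, inner_advectionOp_self] at hadv4
  have hadv5 := inner_advectionOp_add_right c h₁ e₁ (smoothing c)
  have hadv6 := inner_advectionOp_add_right ξ h₁ e₁ (smoothing c)
  have A0 := inner_laplacianOp_add_le c ξ
  rw [← hw₁] at hadv5 hadv6
  rw [← hx] at A0
  rw [← hw₁, ← hw₂, real_inner_comm, inner_sub_left, inner_drift, inner_drift, hlap, hadv1, hadv2,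
    hadv3, hadv4, hadv5, hadv6]
  have hq0 := dirichlet_nonneg h₁
  have hZP : ‖smoothing c‖ ≤ √(dirichlet c) := Real.le_sqrt_of_sq_le (norm_smoothing_sq_le c)
  have hP2 : √(dirichlet c) ^ 2 = dirichlet c := Real.sq_sqrt (dirichlet_nonneg c)
  have hQ2 : √(dirichlet h₁) ^ 2 = dirichlet h₁ := Real.sq_sqrt hq0
  have hb {u : H} {B : ℝ} (hB : 0 ≤ B) (hu : ‖u‖ ≤ B) :
      -inner ℝ u (smoothing c) ≤ B * ‖smoothing c‖ := by
    refine (neg_le_abs _).trans ((abs_real_inner_le_norm _ _).trans ?_)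
    gcongr
  have A1 := (neg_le_abs _).trans (abs_inner_advectionOp_le hc hc0 c h₁)
  have hZ0 : 0 ≤ ‖smoothing c‖ := norm_nonneg _
  have hP0 : 0 ≤ √(dirichlet c) := Real.sqrt_nonneg _
  have hQ0 : 0 ≤ √(dirichlet h₁) := Real.sqrt_nonneg _
  have A2 := hb (u := advectionOp c e₁) (B := C * (2 * ρ) * δ) (by positivity)
    ((hadv _ _).1.trans (by gcongr))
  have A3 := hb (u := advectionOp ξ h₁) (B := C * (2 * δ) * √(dirichlet h₁)) (by positivity)
    ((hadv _ _).2.trans (by gcongr))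
  have A4 := hb (u := advectionOp ξ e₁) (B := C * (2 * δ) * 1) (by positivity)
    ((hadv _ _).1.trans (by
      gcongr
      · exact (norm_smoothing_le ξ).trans hξ
      · exact he₁.trans hδ1))
  have A6 := hb (u := advectionOp w₂ ξ) (B := C * (ρ + 1) * (2 * δ)) (by positivity)
    ((hadv _ _).1.trans (by gcongr))
  have B0 : ‖ξ‖ * ‖smoothing c‖ ≤ 2 * δ * (2 * ρ) := by gcongr
  rw [← hQ2]
  rw [← hP2] at A0
  exact difference_arith hν hδ hC hρ hZ0 hQ0 hZρ hZP B0 A0 A1 A2 A3 A4 A6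

/-! ### Contraction of perturbed solutions -/

/-- `v` is a path from time `s` to `t` with `v' = νΔw - B(𝒦w, w) + f`, where `w - v` is `δ`-small
in `H₃`. -/
def IsPerturbedSolution (ν : ℝ) (f : ℝ → H) (δ s t : ℝ) (v : ℝ → H) : Prop :=
  ContinuousOn v (Icc s t) ∧ ∃ h e : ℝ → H, ∀ u ∈ Ioo s t,
    v u = smoothing (h u) ∧ ‖e u‖ ≤ δ ∧ HasDerivAt v (drift ν (f u) (h u + e u)) u

lemma IsPerturbedSolution.mono {ν : ℝ} {f : ℝ → H} {δ s t t' : ℝ} {v : ℝ → H}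
    (h : IsPerturbedSolution ν f δ s t v) (ht : t' ≤ t) : IsPerturbedSolution ν f δ s t' v := by
  obtain ⟨hc, h, e, H⟩ := h
  exact ⟨hc.mono (Icc_subset_Icc_right ht), h, e, fun u hu => H u ⟨hu.1, hu.2.trans_le ht⟩⟩

/-- Grönwall's inequality for a dissipative differential inequality. -/
lemma le_of_deriv_le_neg_mul_add {Y Y' : ℝ → ℝ} {s t l K : ℝ} (hst : s ≤ t) (hl : 0 < l)
    (hK : 0 ≤ K) (hc : ContinuousOn Y (Icc s t)) (hd : ∀ u ∈ Ioo s t, HasDerivAt Y (Y' u) u)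
    (hle : ∀ u ∈ Ioo s t, Y' u ≤ -l * Y u + K) :
    Y t ≤ Real.exp (-l * (t - s)) * Y s + K / l := by
  have hder (u : ℝ) (hu : u ∈ Ioo s t) : HasDerivAt (fun u => Real.exp (l * u) * (Y u - K / l))
      (Real.exp (l * u) * l * (Y u - K / l) + Real.exp (l * u) * Y' u) u := by
    have h1 : HasDerivAt (fun u => Real.exp (l * u)) (Real.exp (l * u) * l) u := by
      simpa using ((hasDerivAt_id u).const_mul l).exp
    exact h1.mul ((hd u hu).sub_const _)
  have hanti : AntitoneOn (fun u => Real.exp (l * u) * (Y u - K / l)) (Icc s t) := by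
    refine antitoneOn_of_deriv_nonpos (convex_Icc s t) (by fun_prop) ?_ ?_ <;>
      rw [interior_Icc]
    · exact fun u hu => (hder u hu).differentiableAt.differentiableWithinAt
    · intro u hu
      rw [(hder u hu).deriv]
      have h1 := hle u hu
      have h2 : Real.exp (l * u) * l * (Y u - K / l) + Real.exp (l * u) * Y' u =
          Real.exp (l * u) * (Y' u - (-l * Y u + K)) := by
        field_simp
        ring
      rw [h2]
      exact mul_nonpos_of_nonneg_of_nonpos (Real.exp_pos _).le (by linarith)
  have h := hanti (left_mem_Icc.mpr hst) (right_mem_Icc.mpr hst) hst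
  have h3 : Y t - K / l ≤ Real.exp (-l * (t - s)) * (Y s - K / l) := by
    have h4 : Real.exp (l * t) * (Real.exp (-l * (t - s)) * (Y s - K / l)) =
        Real.exp (l * s) * (Y s - K / l) := by
      rw [← mul_assoc, ← Real.exp_add]
      congr 2
      ring
    beta_reduce at h
    rw [← h4] at h
    exact le_of_mul_le_mul_left h (Real.exp_pos _)
  have h5 : 0 ≤ Real.exp (-l * (t - s)) * (K / l) := by positivity
  linarith

/-- A priori bound: the energy of a perturbed solution is bounded in time. -/
lemma IsPerturbedSolution.norm_sq_le {ν δ M C κ R s t : ℝ} {f v : ℝ → H} (hν : 0 < ν) (hδ : 0 ≤ δ)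
    (hδ1 : δ ≤ 1) (hC : 0 ≤ C)
    (hadv : ∀ a b : H, ‖advectionOp a b‖ ≤ C * ‖smoothing a‖ * ‖b‖)
    (hf : ∀ t, ‖f t‖ ≤ M) (hκ : δ * (ν + 3 * C) ≤ κ) (hκν : κ < ν)
    (hv : IsPerturbedSolution ν f δ s t v) (hR : ‖v s‖ ≤ R) {u : ℝ} (hu : u ∈ Icc s t) :
    ‖v u‖ ^ 2 ≤ R ^ 2 + (M ^ 2 / ν + κ) / (ν - κ) := by
  obtain ⟨hc, h, e, H⟩ := hv.mono hu.2
  have hκ0 : 0 ≤ κ := le_trans (by positivity) hκ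
  have hg : ‖v u‖ ^ 2 ≤ Real.exp (-(ν - κ) * (u - s)) * ‖v s‖ ^ 2 + (M ^ 2 / ν + κ) / (ν - κ) :=
    le_of_deriv_le_neg_mul_add (Y := fun u => ‖v u‖ ^ 2)
    (Y' := fun u => 2 * inner ℝ (v u) (drift ν (f u) (h u + e u))) hu.1 (l := ν - κ)
    (K := M ^ 2 / ν + κ) (by linarith) (by positivity) (by fun_prop)
    (fun r hr => (H r hr).2.2.norm_sq) (fun r hr => by
      obtain ⟨h1, h2, -⟩ := H r hr
      have h3 := energy_le hν hδ hδ1 hC hadv (h := h r) h2 (hf r)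
      have h4 := norm_smoothing_sq_le (h r)
      have h5 := dirichlet_nonneg (h r)
      rw [h1]
      have h6 : δ * (ν + 3 * C) * dirichlet (h r) ≤ κ * dirichlet (h r) := by gcongr
      have h7 : (ν - κ) * ‖smoothing (h r)‖ ^ 2 ≤ (ν - κ) * dirichlet (h r) :=
        mul_le_mul_of_nonneg_left h4 (by linarith)
      linarith)
  have h1 : Real.exp (-(ν - κ) * (u - s)) * ‖v s‖ ^ 2 ≤ 1 * R ^ 2 := by
    gcongr
    rw [Real.exp_le_one_iff]
    nlinarith [hu.1]
  linarith

/-- The elementary inequalities behind `exists_contraction`. -/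
lemma contraction_arith {ν M C c₀ κ β l θ E K δ V' y' y X q : ℝ} (hν : 0 < ν) (hβ : 0 ≤ β)
    (hβ2 : β * (ν - κ) = c₀ ^ 2 / ν) (hl : l = ν - β * (M ^ 2 / ν + κ)) (hθ : 0 < θ)
    (hδκ : δ * (ν + 3 * C) ≤ κ) (hδK1 : δ * K ≤ ν * θ) (hδK2 : δ * K ≤ c₀ ^ 2 / ν * θ)
    (hq : 0 ≤ q) (hy : 0 ≤ y) (hX0 : 0 ≤ X) (hX : X ≤ E)
    (hen : V' ≤ -(ν - δ * (ν + 3 * C)) * q + (M ^ 2 / ν + δ * (ν + 3 * C)))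
    (hdi : y' ≤ -ν * y + c₀ ^ 2 / ν * q * y + δ * K * (1 + q)) :
    y' * X + (y + θ) * (X * (β * V')) ≤ -l * ((y + θ) * X) + 2 * ν * θ * E := by
  have k1 : V' ≤ -(ν - κ) * q + (M ^ 2 / ν + κ) := by
    have := mul_le_mul_of_nonneg_right hδκ hq
    linarith
  have k2 : β * (y + θ) * V' ≤ β * (y + θ) * (-(ν - κ) * q + (M ^ 2 / ν + κ)) :=
    mul_le_mul_of_nonneg_left k1 (by positivity)
  have k3 : β * (y + θ) * (-(ν - κ) * q + (M ^ 2 / ν + κ)) =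
      -(c₀ ^ 2 / ν) * q * (y + θ) + (ν - l) * (y + θ) := by
    rw [← hβ2, hl]
    ring
  have k4 : δ * K * q ≤ c₀ ^ 2 / ν * θ * q := by gcongr
  have k5 : y' + β * (y + θ) * V' ≤ -l * (y + θ) + 2 * ν * θ := by
    rw [k3] at k2
    linarith
  have k6 := mul_le_mul_of_nonneg_right k5 hX0
  have k7 : 2 * ν * θ * X ≤ 2 * ν * θ * E := by gcongr
  linarith

set_option maxHeartbeats 1000000 in
/-- If the Grashof number is small, any two perturbed solutions approach each other. The weight
`exp (β ‖v₁‖²)` turns the dissipation of energy of the first solution into the time average of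
`‖v₁‖₁²` that is needed to control the growth of the difference. -/
lemma exists_contraction {ν M c₀ R : ℝ} (hν : 0 < ν) (hM : 0 ≤ M) (hR : 0 < R)
    (hc : IsLadyzhenskayaConst c₀) (hc0 : 0 < c₀) (hG : c₀ * M < ν ^ 2) :
    ∃ ρ : ℝ, 0 < ρ ∧ ∀ τ : ℝ, 0 < τ → ∃ T₀ δ : ℝ, 0 < T₀ ∧ 0 < δ ∧ δ ≤ τ ∧
      ∀ (f : ℝ → H), (∀ t, ‖f t‖ ≤ M) → ∀ (s t : ℝ), s + T₀ ≤ t → ∀ v₁ v₂ : ℝ → H,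
        IsPerturbedSolution ν f δ s t v₁ → IsPerturbedSolution ν f δ s t v₂ →
        ‖v₁ s‖ ≤ R → ‖v₂ s‖ ≤ R → ‖v₁ t‖ ≤ ρ ∧ ‖v₂ t‖ ≤ ρ ∧ ‖v₁ t - v₂ t‖ ≤ τ := by
  obtain ⟨C, hC, hadv⟩ := exists_norm_advectionOp_le
  have hD : 0 < ν ^ 3 - c₀ ^ 2 * M ^ 2 / ν := by
    rw [sub_pos, div_lt_iff₀ hν, ← mul_pow]
    have : (c₀ * M) ^ 2 < (ν ^ 2) ^ 2 := by gcongr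
    nlinarith
  -- The loss `κ` of dissipation that the spectral gap `ν - c₀² M² / ν³` can afford.
  obtain ⟨κ, hκdef⟩ : ∃ κ, κ = (ν ^ 3 - c₀ ^ 2 * M ^ 2 / ν) / (2 * (c₀ ^ 2 + ν ^ 2)) := ⟨_, rfl⟩
  have hκ : 0 < κ := by rw [hκdef]; positivity
  have hκ2 : κ * (2 * (c₀ ^ 2 + ν ^ 2)) = ν ^ 3 - c₀ ^ 2 * M ^ 2 / ν := by
    rw [hκdef]
    field_simp
  have hκν : κ < ν := by
    have h1 : 0 ≤ c₀ ^ 2 * M ^ 2 / ν := by positivity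
    by_contra! h
    have h2 : ν * (2 * (c₀ ^ 2 + ν ^ 2)) ≤ κ * (2 * (c₀ ^ 2 + ν ^ 2)) := by gcongr
    have h3 : 0 < ν ^ 3 := by positivity
    have h4 : 0 < ν * c₀ ^ 2 := by positivity
    nlinarith
  have hνκ : 0 < ν - κ := sub_pos.mpr hκν
  -- With this `β` the derivative of the weight cancels the growth term `c₀² / ν ‖v₁‖₁²`.
  obtain ⟨β, hβdef⟩ : ∃ β, β = c₀ ^ 2 / ν / (ν - κ) := ⟨_, rfl⟩
  have hβ : 0 < β := by rw [hβdef]; positivity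
  have hβ2 : β * (ν - κ) = c₀ ^ 2 / ν := by rw [hβdef]; field_simp
  obtain ⟨l, hldef⟩ : ∃ l, l = ν - β * (M ^ 2 / ν + κ) := ⟨_, rfl⟩
  have hl : 0 < l := by
    rw [hldef, sub_pos, hβdef, div_div, div_mul_eq_mul_div, div_lt_iff₀ (by positivity)]
    have : 0 < κ * (c₀ ^ 2 + ν ^ 2) := by positivity
    have h1 : c₀ ^ 2 * (M ^ 2 / ν) = c₀ ^ 2 * M ^ 2 / ν := by ring
    nlinarith
  -- The a priori bound of `IsPerturbedSolution.norm_sq_le`.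
  obtain ⟨ρ, hρdef⟩ : ∃ ρ, ρ = √(R ^ 2 + (M ^ 2 / ν + κ) / (ν - κ)) := ⟨_, rfl⟩
  have hρ2 : ρ ^ 2 = R ^ 2 + (M ^ 2 / ν + κ) / (ν - κ) := by
    rw [hρdef]
    exact Real.sq_sqrt (by positivity)
  have hρ : 0 < ρ := by rw [hρdef]; positivity
  refine ⟨ρ, hρ, fun τ hτ => ?_⟩
  obtain ⟨E, hEdef⟩ : ∃ E, E = Real.exp (β * ρ ^ 2) := ⟨_, rfl⟩
  have hE : 0 < E := by rw [hEdef]; positivity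
  -- The constant `θ` absorbs the errors of size `δ (1 + ‖v₁‖₁²)`.
  obtain ⟨θ, hθ, hθ1, hθ2⟩ : ∃ θ : ℝ, 0 < θ ∧ θ ≤ 1 ∧ 2 * ν * θ * E / l ≤ τ ^ 2 / 2 := by
    refine ⟨min 1 (τ ^ 2 * l / (4 * ν * E)), by positivity, min_le_left _ _, ?_⟩
    have : min 1 (τ ^ 2 * l / (4 * ν * E)) ≤ τ ^ 2 * l / (4 * ν * E) := min_le_right _ _
    calc _ ≤ 2 * ν * (τ ^ 2 * l / (4 * ν * E)) * E / l := by gcongr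
      _ = _ := by field_simp; norm_num
  obtain ⟨T₀, hT₀, hT₀2⟩ : ∃ T₀ : ℝ, 0 < T₀ ∧
      Real.exp (-l * T₀) * ((4 * ρ ^ 2 + 1) * E) ≤ τ ^ 2 / 2 := by
    have hx : 0 < τ ^ 2 / 2 / ((4 * ρ ^ 2 + 1) * E) := by positivity
    set x := τ ^ 2 / 2 / ((4 * ρ ^ 2 + 1) * E)
    refine ⟨1 / (l * x), by positivity, ?_⟩
    rw [← le_div_iff₀ (by positivity)]
    have h1 : -l * (1 / (l * x)) = -x⁻¹ := by field_simp
    rw [h1, Real.exp_neg]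
    refine inv_le_of_inv_le₀ hx ?_
    have := Real.add_one_le_exp x⁻¹
    linarith
  obtain ⟨K, hKdef⟩ : ∃ K, K = 8 * ν * ρ + 16 * C * ρ ^ 2 + 24 * C * ρ := ⟨_, rfl⟩
  have hK : 0 < K := by rw [hKdef]; positivity
  obtain ⟨δ, hδ, hδτ, hδ1, hδκ, hδK1, hδK2⟩ : ∃ δ : ℝ, 0 < δ ∧ δ ≤ τ ∧ δ ≤ 1 ∧
      δ * (ν + 3 * C) ≤ κ ∧ δ * K ≤ ν * θ ∧ δ * K ≤ c₀ ^ 2 / ν * θ := by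
    refine ⟨min (min τ 1) (min (κ / (ν + 3 * C)) (min (ν * θ / K) (c₀ ^ 2 / ν * θ / K))),
      by positivity, by simp, by simp, ?_, ?_, ?_⟩
    · rw [← le_div_iff₀ (by positivity)]; simp
    · rw [← le_div_iff₀ (by positivity)]; simp
    · rw [← le_div_iff₀ (by positivity)]; simp
  refine ⟨T₀, δ, hT₀, hδ, hδτ, fun f hf s t hst v₁ v₂ hv₁ hv₂ hR₁ hR₂ => ?_⟩
  have hst' : s ≤ t := by linarith
  have hb₁ {u : ℝ} (hu : u ∈ Icc s t) : ‖v₁ u‖ ≤ ρ :=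
    (le_abs_self _).trans <| abs_le_of_sq_le_sq (hρ2 ▸ hv₁.norm_sq_le hν hδ.le hδ1 hC
      (fun a b => (hadv a b).1) hf hδκ hκν hR₁ hu) hρ.le
  have hb₂ {u : ℝ} (hu : u ∈ Icc s t) : ‖v₂ u‖ ≤ ρ :=
    (le_abs_self _).trans <| abs_le_of_sq_le_sq (hρ2 ▸ hv₂.norm_sq_le hν hδ.le hδ1 hC
      (fun a b => (hadv a b).1) hf hδκ hκν hR₂ hu) hρ.le
  refine ⟨hb₁ (right_mem_Icc.mpr hst'), hb₂ (right_mem_Icc.mpr hst'), ?_⟩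
  obtain ⟨hc₁, h₁, e₁, H₁⟩ := hv₁
  obtain ⟨hc₂, h₂, e₂, H₂⟩ := hv₂
  let Y (u : ℝ) : ℝ := (‖v₁ u - v₂ u‖ ^ 2 + θ) * Real.exp (β * ‖v₁ u‖ ^ 2)
  let D₁ (u : ℝ) : H := drift ν (f u) (h₁ u + e₁ u)
  let D₂ (u : ℝ) : H := drift ν (f u) (h₂ u + e₂ u)
  have hg := le_of_deriv_le_neg_mul_add (Y := Y)
    (Y' := fun u => 2 * inner ℝ (v₁ u - v₂ u) (D₁ u - D₂ u) * Real.exp (β * ‖v₁ u‖ ^ 2) +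
      (‖v₁ u - v₂ u‖ ^ 2 + θ) *
        (Real.exp (β * ‖v₁ u‖ ^ 2) * (β * (2 * inner ℝ (v₁ u) (D₁ u))))) hst' hl
    (K := 2 * ν * θ * E) (by positivity) (by fun_prop)
    (fun u hu => by
      have d₁ := (H₁ u hu).2.2
      have d₂ := (H₂ u hu).2.2
      exact ((d₁.sub d₂).norm_sq.add_const θ).mul (d₁.norm_sq.const_mul β).exp)
    (fun u hu => by
      obtain ⟨a1, a2, -⟩ := H₁ u hu
      obtain ⟨b1, b2, -⟩ := H₂ u hu
      have hu' : u ∈ Icc s t := Ioo_subset_Icc_self hu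
      have i1 := hb₁ hu'
      have i2 := hb₂ hu'
      have hen := energy_le hν hδ.le hδ1 hC (fun a b => (hadv a b).1) (h := h₁ u) a2 (hf u)
      have hdi := difference_le (f := f u) hν hδ.le hδ1 hC hρ.le hc hc0.le hadv a2 b2
        (by rwa [← a1]) (by rwa [← b1])
      rw [← a1] at hen
      rw [← a1, ← b1, ← hKdef] at hdi
      change 2 * inner ℝ (v₁ u) (D₁ u) ≤ _ at hen
      change 2 * inner ℝ (v₁ u - v₂ u) (D₁ u - D₂ u) ≤ _ at hdi
      have hq := dirichlet_nonneg (h₁ u)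
      have hy : 0 ≤ ‖v₁ u - v₂ u‖ ^ 2 := by positivity
      have hexp : Real.exp (β * ‖v₁ u‖ ^ 2) ≤ E := by rw [hEdef]; gcongr
      change _ ≤ -l * ((‖v₁ u - v₂ u‖ ^ 2 + θ) * Real.exp (β * ‖v₁ u‖ ^ 2)) + _
      exact contraction_arith hν hβ.le hβ2 hldef hθ hδκ hδK1 hδK2 hq hy (Real.exp_pos _).le hexp
        hen hdi)
  have hs := left_mem_Icc.mpr hst'
  have hYs : Y s ≤ (4 * ρ ^ 2 + 1) * E := by
    have h1 : ‖v₁ s - v₂ s‖ ≤ 2 * ρ :=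
      (norm_sub_le _ _).trans (by linarith [hb₁ hs, hb₂ hs])
    have h2 : ‖v₁ s - v₂ s‖ ^ 2 ≤ (2 * ρ) ^ 2 := by gcongr
    have h3 : Real.exp (β * ‖v₁ s‖ ^ 2) ≤ E := by
      rw [hEdef]
      have := hb₁ hs
      gcongr
    refine mul_le_mul ?_ h3 (Real.exp_pos _).le (by positivity)
    linarith
  have hYt : ‖v₁ t - v₂ t‖ ^ 2 ≤ Y t := by
    have h1 : 1 ≤ Real.exp (β * ‖v₁ t‖ ^ 2) := Real.one_le_exp (by positivity)
    refine le_trans ?_ (le_mul_of_one_le_right (by positivity) h1)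
    linarith
  have hexp : Real.exp (-l * (t - s)) * Y s ≤ Real.exp (-l * T₀) * ((4 * ρ ^ 2 + 1) * E) := by
    have hYs0 : 0 ≤ Y s := by positivity
    refine mul_le_mul (Real.exp_le_exp.mpr ?_) hYs hYs0 (Real.exp_pos _).le
    nlinarith
  refine (le_abs_self _).trans (abs_le_of_sq_le_sq ?_ hτ.le)
  linarith

/-! ### Removing the noise from a solution -/

lemma inner_laplacianOp_smoothing (a b : H) :
    inner ℝ (laplacianOp a) (smoothing b) = inner ℝ (smoothing a) (laplacianOp b) := by
  refine (hasSum_inner _ _).unique ?_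
  convert! hasSum_inner (smoothing a) (laplacianOp b) using 2 with k
  rw [coeff_laplacianOp, coeff_smoothing, coeff_laplacianOp, coeff_smoothing]
  congr 2
  simp only [map_mul, map_neg, Complex.conj_ofReal]
  ring

lemma integral_laplacian (w c : H) :
    ∫ x, (w : Lp ℝ 2 (volume : Measure Torus)) x * laplacian (smoothing c) x =
      inner ℝ w (laplacianOp c) := by
  rw [real_inner_comm, Submodule.coe_inner, L2.inner_def]
  refine integral_congr_ae ?_
  filter_upwards [laplacian_ae_eq c] with x hx
  rw [hx, real_inner_eq_re_inner ℝ, RCLike.inner_apply]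
  simp

/-- The weak form of the deterministic part of the equation, for a state in `H₃`. -/
lemma weak_drift_eq (ν : ℝ) (f a c : H) :
    ν * (∫ x, (smoothing a : Lp ℝ 2 (volume : Measure Torus)) x * laplacian (smoothing c) x)
      - (∫ x, advection (smoothing a) (smoothing a) x *
          (smoothing c : Lp ℝ 2 (volume : Measure Torus)) x) + inner ℝ f (smoothing c)
      = inner ℝ (drift ν f a) (smoothing c) := by
  rw [inner_drift, integral_laplacian, integral_advection, inner_laplacianOp_smoothing]

lemma ofReal_norm_le_sobolevNorm_one (w : H) : ENNReal.ofReal ‖w‖ ≤ sobolevNorm 1 w := by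
  rcases eq_or_ne (sobolevNorm 1 w) ∞ with h | h
  · rw [h]; exact le_top
  have hs := summable_of_sobolevNorm_lt_top (lt_top_iff_ne_top.mpr h)
  obtain ⟨S, hS⟩ := hs
  have hle : ‖w‖ ^ 2 ≤ S := by
    refine hasSum_le (fun k => ?_) (hasSum_norm_sq w) hS
    rw [Real.rpow_one, mul_assoc (4 * Real.pi ^ 2)]
    gcongr 4 * Real.pi ^ 2 * ?_
    rcases eq_or_ne k 0 with rfl | hk
    · simp [coeff_zero_right]
    · rw [← freq_sq]
      exact le_mul_of_one_le_left (by positivity) (one_le_pow₀ (one_le_freq hk))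
  have hS0 : 0 ≤ S := le_trans (by positivity) hle
  rw [sobolevNorm_eq (S := √S) (Real.sqrt_nonneg _) (by rwa [Real.sq_sqrt hS0])]
  exact ENNReal.ofReal_le_ofReal (Real.le_sqrt_of_sq_le hle)

lemma SobolevContinuousOn.continuousOn {u : ℝ → H} {S : Set ℝ} (h : SobolevContinuousOn 1 u S) :
    ContinuousOn u S := by
  intro t ht
  rw [ContinuousWithinAt, tendsto_iff_norm_sub_tendsto_zero]
  have h1 := (ENNReal.tendsto_toReal ENNReal.zero_ne_top).comp
    (tendsto_of_tendsto_of_tendsto_of_le_of_le tendsto_const_nhds (h t ht).2 (fun _ => zero_le)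
      fun r => ofReal_norm_le_sobolevNorm_one (u r - u t))
  refine h1.congr fun r => ?_
  rw [Function.comp_apply, ENNReal.toReal_ofReal (norm_nonneg _)]

/-- A path in `H₃` is the image of a path in the state space under `smoothing`. -/
lemma SobolevContinuousOn.exists_eq_smoothing {u : ℝ → H} {S : Set ℝ}
    (h : SobolevContinuousOn 3 u S) :
    ∃ a : ℝ → H, ContinuousOn a S ∧ ∀ t ∈ S, u t = smoothing (a t) := by
  have h0 (t : ℝ) : ∃ a, t ∈ S → smoothing a = u t := by
    by_cases ht : t ∈ S
    · obtain ⟨a, ha⟩ := exists_smoothing_eq (h t ht).1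
      exact ⟨a, fun _ => ha⟩
    · exact ⟨0, fun h => absurd h ht⟩
  choose a ha using h0
  refine ⟨a, fun t ht => ?_, fun t ht => (ha t ht).symm⟩
  rw [ContinuousWithinAt, tendsto_iff_norm_sub_tendsto_zero]
  refine ((ENNReal.tendsto_toReal ENNReal.zero_ne_top).comp (h t ht).2).congr' ?_
  filter_upwards [self_mem_nhdsWithin] with r hr
  rw [Function.comp_apply, ← ha r hr, ← ha t ht, ← map_sub, sobolevNorm_three_smoothing,
    ENNReal.toReal_ofReal (norm_nonneg _)]

lemma continuousOn_drift {ν : ℝ} {f a : ℝ → H} {S : Set ℝ} (hf : ContinuousOn f S)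
    (ha : ContinuousOn a S) : ContinuousOn (fun u => drift ν (f u) (a u)) S := by
  unfold drift
  have h1 : ContinuousOn (fun u => advectionOp (a u) (a u)) S :=
    (advectionOp.continuous.comp_continuousOn ha).clm_apply ha
  have h2 : ContinuousOn (fun u => ν • laplacianOp (a u)) S :=
    (laplacianOp.continuous.comp_continuousOn ha).const_smul ν
  exact (h2.sub h1).add hf

/-- The weak form of the drift is integrable up to the initial time, although the drift itself need
not be. -/
lemma intervalIntegrable_inner_drift {ν s t : ℝ} {f a w : ℝ → H} (hst : s ≤ t) (hf : Continuous f)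
    (ha : ContinuousOn a (Ioi s)) (hw : ContinuousOn w (Ici s))
    (haw : ∀ u ∈ Ioi s, w u = smoothing (a u)) (c : H) :
    IntervalIntegrable (fun u => inner ℝ (drift ν (f u) (a u)) (smoothing c)) volume s t := by
  obtain ⟨C, hC, hadv⟩ := exists_norm_advectionOp_le
  obtain ⟨Mw, hMw⟩ := isCompact_Icc.exists_bound_of_continuousOn (hw.mono Icc_subset_Ici_self :
    ContinuousOn w (Icc s t))
  obtain ⟨Mf, hMf⟩ := isCompact_Icc.exists_bound_of_continuousOn (hf.continuousOn :
    ContinuousOn f (Icc s t))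
  rw [intervalIntegrable_iff_integrableOn_Ioc_of_le hst]
  have hcont : ContinuousOn (fun u => inner ℝ (drift ν (f u) (a u)) (smoothing c)) (Ioc s t) :=
    ((continuousOn_drift hf.continuousOn ha).mono Ioc_subset_Ioi_self).inner continuousOn_const
  refine ⟨hcont.aestronglyMeasurable measurableSet_Ioc, HasFiniteIntegral.restrict_of_bounded
    (|ν| * (Mw * ‖laplacianOp c‖) + C * Mw * ‖c‖ * Mw + Mf * ‖smoothing c‖) (by simp) ?_⟩
  refine (ae_restrict_iff' measurableSet_Ioc).mpr (ae_of_all _ fun u hu => ?_)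
  have hw1 := hMw u (Ioc_subset_Icc_self hu)
  have hf1 := hMf u (Ioc_subset_Icc_self hu)
  have hMw0 : 0 ≤ Mw := (norm_nonneg _).trans hw1
  rw [inner_drift, inner_laplacianOp_smoothing, inner_advectionOp_antisymm, ← haw u hu.1,
    Real.norm_eq_abs]
  refine (abs_add_le _ _).trans (add_le_add ((abs_sub _ _).trans (add_le_add ?_ ?_)) ?_)
  · rw [abs_mul]
    gcongr
    refine (abs_real_inner_le_norm _ _).trans ?_
    gcongr
  · rw [abs_neg]
    refine (abs_real_inner_le_norm _ _).trans ?_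
    have := (hadv (a u) c).1
    rw [← haw u hu.1] at this
    calc _ ≤ C * ‖w u‖ * ‖c‖ * ‖w u‖ := by gcongr
      _ ≤ _ := by gcongr
  · refine (abs_real_inner_le_norm _ _).trans ?_
    gcongr

/-- The primitive of the noise, in the coordinates in which `smoothing` has been removed. -/
noncomputable def noisePath {d : ℕ} (γ : Fin d → H) (B : ℝ → Fin d → ℝ) (s t : ℝ) : H :=
  ∑ i, (B t i - B s i) • γ i

lemma inner_smoothing_noisePath {d : ℕ} (γ : Fin d → H) (B : ℝ → Fin d → ℝ) (s t : ℝ) (φ : H) :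
    inner ℝ (smoothing (noisePath γ B s t)) φ =
      ∑ i, inner ℝ (smoothing (γ i)) φ * (B t i - B s i) := by
  rw [noisePath, map_sum, sum_inner]
  refine Finset.sum_congr rfl fun i _ => ?_
  rw [map_smul]
  exact (real_inner_smul_left (F := H) _ _ _).trans (mul_comm _ _)

lemma norm_noisePath_le {d : ℕ} {γ : Fin d → H} {B : ℝ → Fin d → ℝ} {s t δ : ℝ}
    (h : ∀ i, |B t i - B s i| ≤ δ) : ‖noisePath γ B s t‖ ≤ δ * ∑ i, ‖γ i‖ := by
  rw [Finset.mul_sum]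
  refine norm_sum_le_of_le _ fun i _ => (norm_smul_le _ _).trans ?_
  exact mul_le_mul_of_nonneg_right (h i) (norm_nonneg _)

/-- Subtracting the noise from a path which solves the weak equation gives a strong solution of the
randomly perturbed deterministic equation. -/
lemma isPerturbedSolution_sub_noise {d : ℕ} {ν s t₁ δ : ℝ} {f w : ℝ → H} {w₀ : H} {γ : Fin d → H}
    {B : ℝ → Fin d → ℝ} (hf : Continuous f) (hB : Continuous B)
    (hw : ContinuousOn w (Ici s)) (hreg : SobolevContinuousOn 3 w (Ioi s))
    (heq : ∀ φ : H, IsSmooth φ → ∀ t, s ≤ t →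
      inner ℝ (w t) φ = inner ℝ w₀ φ
        + (∫ u in s..t, (ν * (∫ x, (w u : Lp ℝ 2 volume) x * laplacian φ x)
            - (∫ x, advection (w u) (w u) x * (φ : Lp ℝ 2 volume) x) + inner ℝ (f u) φ))
        + ∑ i, inner ℝ (smoothing (γ i)) φ * (B t i - B s i))
    (hsmall : ∀ t ∈ Icc s t₁, ∀ i, |B t i - B s i| ≤ δ) :
    IsPerturbedSolution ν f (δ * ∑ i, ‖γ i‖) s t₁
      (fun t => w t - smoothing (noisePath γ B s t)) := by
  have he : Continuous (noisePath γ B s) := by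
    unfold noisePath
    exact continuous_finsetSum _ fun i _ =>
      (((continuous_apply i).comp hB).sub continuous_const).smul continuous_const
  obtain ⟨a, ha, haw⟩ := hreg.exists_eq_smoothing
  let F (u : ℝ) : H := drift ν (f u) (a u)
  have hF : ContinuousOn F (Ioi s) := continuousOn_drift hf.continuousOn ha
  have hFi {t₀ t : ℝ} (h0 : s < t₀) (h1 : s < t) : IntervalIntegrable F volume t₀ t :=
    (hF.mono fun u hu => (lt_min h0 h1).trans_le hu.1).intervalIntegrable
  have key {t₀ t : ℝ} (h0 : s < t₀) (h1 : s < t) :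
      w t - smoothing (noisePath γ B s t) =
        w t₀ - smoothing (noisePath γ B s t₀) + ∫ u in t₀..t, F u := by
    rw [← sub_eq_zero]
    refine eq_zero_of_inner_smooth fun φ hφ => ?_
    obtain ⟨c, rfl⟩ := exists_smoothing_eq (hφ 3 (by norm_num))
    have hint {t : ℝ} (ht : s < t) : inner ℝ (w t) (smoothing c) = inner ℝ w₀ (smoothing c)
        + (∫ u in s..t, inner ℝ (F u) (smoothing c))
        + inner ℝ (smoothing (noisePath γ B s t)) (smoothing c) := by
      rw [heq _ hφ t ht.le, inner_smoothing_noisePath]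
      congr 2
      refine intervalIntegral.integral_congr_ae (ae_of_all _ fun u hu => ?_)
      rw [uIoc_of_le ht.le] at hu
      rw [haw u hu.1, weak_drift_eq]
    have hI : inner ℝ (∫ u in t₀..t, F u) (smoothing c) =
        ∫ u in t₀..t, inner ℝ (F u) (smoothing c) := by
      have := ((innerSL ℝ (smoothing c)).intervalIntegral_comp_comm (hFi h0 h1)).symm
      rw [innerSL_apply_apply, real_inner_comm] at this
      rw [this]
      exact intervalIntegral.integral_congr fun u _ => real_inner_comm (F u) _
    have hadd := intervalIntegral.integral_interval_sub_left
      (intervalIntegrable_inner_drift (ν := ν) h1.le hf ha hw haw c)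
      (intervalIntegrable_inner_drift (ν := ν) h0.le hf ha hw haw c)
    rw [inner_sub_left, inner_add_left, inner_sub_left, inner_sub_left, hI, hint h0, hint h1]
    linarith
  refine ⟨(hw.mono Icc_subset_Ici_self).sub
      (smoothing.continuous.comp he).continuousOn,
    fun u => a u - noisePath γ B s u, noisePath γ B s, fun u hu => ⟨?_, ?_, ?_⟩⟩
  · beta_reduce
    rw [map_sub, haw u hu.1]
  · exact norm_noisePath_le (hsmall u (Ioo_subset_Icc_self hu))
  · rw [sub_add_cancel]
    have hsu : s < u := hu.1
    have h1 : HasDerivAt (fun t => w u - smoothing (noisePath γ B s u) + ∫ r in u..t, F r)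
        (F u) u :=
      (intervalIntegral.integral_hasDerivAt_right (hFi hsu hsu)
        (hF.stronglyMeasurableAtFilter isOpen_Ioi u hsu)
        (hF.continuousAt (Ioi_mem_nhds hsu))).const_add _
    refine h1.congr_of_eventuallyEq ?_
    filter_upwards [Ioi_mem_nhds hsu] with t ht
    exact key hsu ht

/-! ### The law of the solution charges small neighbourhoods of perturbed solutions -/

lemma noiseHistory_le {Ω : Type} [MeasurableSpace Ω] {P : Measure Ω} {d : ℕ}
    {W : ℝ → Ω → Fin d → ℝ} (hW : IsTwoSidedBrownian W P) (t : ℝ) :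
    noiseHistory W t ≤ (inferInstance : MeasurableSpace Ω) :=
  iSup₂_le fun u _ => (hW.measurable u).comap_le

lemma IsTransitionProbability.isProbabilityMeasure {ν s t : ℝ} {f : ℝ → H} {d : ℕ}
    {g : Fin d → H} {w₀ : H} {μ : Measure H} (h : IsTransitionProbability ν f g s t w₀ μ)
    (hst : s ≤ t) : IsProbabilityMeasure μ := by
  obtain ⟨Ω, _, P, W, w, hP, hW, hw, rfl⟩ := h
  exact Measure.isProbabilityMeasure_map
    ((hw.adapted t hst).mono (noiseHistory_le hW t)).aemeasurable

/-- With a probability bounded below uniformly in `s` and `w₀`, the solution ends `δ`-close to the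
end of a perturbed solution with the same initial condition. -/
lemma exists_transition_le {ν δ T : ℝ} {f : ℝ → H} {d : ℕ} {g : Fin d → H} (hf : Continuous f)
    (hg : ∀ i, IsSmooth (g i)) (hδ : 0 < δ) (hT : 0 ≤ T) :
    ∃ p : ℝ≥0∞, 0 < p ∧ ∀ (s : ℝ) (w₀ : H) (μ : Measure H),
      IsTransitionProbability ν f g s (s + T) w₀ μ →
      p ≤ μ {x | ∃ v, IsPerturbedSolution ν f δ s (s + T) v ∧ v s = w₀ ∧ ‖x - v (s + T)‖ ≤ δ} := by
  choose γ hγ using fun i => exists_smoothing_eq (hg i 3 (by norm_num))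
  have hN : 0 < δ / (∑ i, ‖γ i‖ + 1) := by positivity
  have hNδ : δ / (∑ i, ‖γ i‖ + 1) * ∑ i, ‖γ i‖ ≤ δ := by
    rw [div_mul_eq_mul_div]
    refine div_le_of_le_mul₀ (by positivity) hδ.le ?_
    gcongr
    exact (lt_add_one _).le
  obtain ⟨p, hp, hsmall⟩ := exists_small_noise hT hN d
  refine ⟨p, hp, fun s w₀ μ hμ => ?_⟩
  obtain ⟨Ω, _, P, W, w, hP, hW, hw, rfl⟩ := hμ
  have hsT : s ≤ s + T := by linarith
  obtain ⟨E, hE, hEω⟩ := hsmall Ω _ P W hP hW s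
  refine hE.trans (le_trans ?_ (Measure.le_map_apply
    ((hw.adapted (s + T) hsT).mono (noiseHistory_le hW _)).aemeasurable _))
  refine measure_mono_ae ?_
  filter_upwards [hw.initial, hw.continuous, hw.regular, hw.equation] with ω h1 h2 h3 h4 hω
  obtain ⟨hB, hB'⟩ := hEω ω hω
  have hv := isPerturbedSolution_sub_noise (γ := γ) hf hB h2 h3
    (fun φ hφ t ht => by simp only [hγ]; exact h4 φ hφ t ht) hB'
  refine ⟨_, ⟨hv.1, ?_⟩, ?_, ?_⟩
  · obtain ⟨h, e, H⟩ := hv.2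
    exact ⟨h, e, fun u hu => ⟨(H u hu).1, (H u hu).2.1.trans hNδ, (H u hu).2.2⟩⟩
  · have h0 : noisePath γ (fun t => W t ω) s s = 0 :=
      Finset.sum_eq_zero fun i _ => by rw [sub_self]; exact zero_smul ℝ (γ i)
    rw [h0, map_zero, sub_zero, h1]
  · rw [sub_sub_cancel]
    exact (norm_smoothing_le _).trans
      ((norm_noisePath_le (hB' _ (right_mem_Icc.mpr hsT))).trans hNδ)

/-! ### The weighted distance -/

/-- The straight line bounds the weighted distance. -/
lemma weightedDist_le {η r K : ℝ} (hη : 0 ≤ η) (hr : 0 ≤ r) {w₁ w₂ : H} (h₁ : ‖w₁‖ ≤ K)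
    (h₂ : ‖w₂‖ ≤ K) :
    weightedDist η r w₁ w₂ ≤ ENNReal.ofReal (Real.exp (η * K ^ 2 * r) * ‖w₁ - w₂‖) := by
  have hder (t : ℝ) : HasDerivAt (fun t : ℝ => w₁ + t • (w₂ - w₁)) (w₂ - w₁) t := by
    have := ((hasDerivAt_id t).smul_const (w₂ - w₁)).const_add w₁
    rwa [one_smul] at this
  have h0 : w₁ + (0 : ℝ) • (w₂ - w₁) = w₁ := by rw [zero_smul, add_zero]
  have h1 : w₁ + (1 : ℝ) • (w₂ - w₁) = w₂ := by rw [one_smul, add_sub_cancel]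
  refine (iInf₂_le (fun t : ℝ => w₁ + t • (w₂ - w₁))
    ⟨fun t _ => (hder t).differentiableAt.differentiableWithinAt, h0, h1⟩).trans ?_
  calc _ ≤ ∫⁻ _ in Icc (0 : ℝ) 1, ENNReal.ofReal (Real.exp (η * K ^ 2 * r) * ‖w₁ - w₂‖) := by
        refine setLIntegral_mono measurable_const fun t ht => ENNReal.ofReal_le_ofReal ?_
        rw [(hder t).hasDerivWithinAt.derivWithin (uniqueDiffOn_Icc_zero_one t ht),
          norm_sub_rev w₂ w₁, lyapunov, ← Real.exp_mul]
        have hK : ‖w₁ + t • (w₂ - w₁)‖ ≤ K := by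
          have := (convex_closedBall (0 : H) K).add_smul_sub_mem
            (mem_closedBall_zero_iff.mpr h₁) (mem_closedBall_zero_iff.mpr h₂) ht
          exact mem_closedBall_zero_iff.mp this
        gcongr
    _ = _ := by
        rw [setLIntegral_const, Real.volume_Icc, sub_zero, ENNReal.ofReal_one, mul_one]

/-- The product coupling. -/
lemma exists_coupling_prod {α β : Type*} [MeasurableSpace α] [MeasurableSpace β] (μ : Measure α)
    (μ' : Measure β) [IsProbabilityMeasure μ] [IsProbabilityMeasure μ'] : ∃ Γ : Measure (α × β),
      Γ.map Prod.fst = μ ∧ Γ.map Prod.snd = μ' ∧ ∀ s t, Γ (s ×ˢ t) = μ s * μ' t :=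
  ⟨μ.prod μ', by simp, by simp, fun s t => Measure.prod_prod s t⟩

end StochasticNS

theorem mainTheorem9 (ν 𝒯 η c₀ : ℝ) (hν : 0 < ν) (h𝒯 : 0 < 𝒯) (hη : 0 < η)
    (hc₀ : StochasticNS.IsLadyzhenskayaConst c₀)
    (d : ℕ) (g : Fin d → StochasticNS.H) (hg : ∀ i, StochasticNS.IsSmooth (g i))
    (f : ℝ → StochasticNS.H) (hf_per : Function.Periodic f 𝒯)
    (hf_cont : StochasticNS.SobolevContinuousOn 1 f Set.univ)
    (hf_loc : ∀ a b : ℝ, ∫⁻ t in Set.Icc a b, StochasticNS.sobolevNorm 2 (f t) ^ 2 < ⊤)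
    (hG : StochasticNS.grashof ν f < 1 / c₀)
    (R ε r : ℝ) (hR : 0 < R) (hε : 0 < ε) (hr : r ∈ Set.Ioc (0 : ℝ) 1) :
    ∃ n₀ : ℕ, ∀ n : ℕ, n₀ ≤ n → ∃ a : ℝ, 0 < a ∧
      ∀ (s : ℝ) (w₁ w₂ : StochasticNS.H), ‖w₁‖ ≤ R → ‖w₂‖ ≤ R →
      ∀ μ₁ μ₂ : MeasureTheory.Measure StochasticNS.H,
        StochasticNS.IsTransitionProbability ν f g s (s + n * 𝒯) w₁ μ₁ →
        StochasticNS.IsTransitionProbability ν f g s (s + n * 𝒯) w₂ μ₂ →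
        ∃ Γ : MeasureTheory.Measure (StochasticNS.H × StochasticNS.H),
          StochasticNS.IsCoupling Γ μ₁ μ₂ ∧
          ENNReal.ofReal a ≤
            Γ {p | StochasticNS.weightedDist η r p.1 p.2 < ENNReal.ofReal ε} := by
  have hf : Continuous f := continuousOn_univ.mp hf_cont.continuousOn
  have hM0 : 0 ≤ ⨆ t, ‖f t‖ := Real.iSup_nonneg fun _ => norm_nonneg _
  have hM (t : ℝ) : ‖f t‖ ≤ ⨆ t, ‖f t‖ := by
    have hper : Function.Periodic (fun t => ‖f t‖) 𝒯 := fun t => congrArg norm (hf_per t)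
    exact le_ciSup (hper.compact_of_continuous h𝒯.ne' hf.norm).bddAbove t
  rw [StochasticNS.grashof] at hG
  have hc0 : 0 < c₀ := one_div_pos.mp (lt_of_le_of_lt (by positivity) hG)
  rw [div_lt_div_iff₀ (by positivity) hc0, one_mul, mul_comm] at hG
  obtain ⟨ρ, hρ, hcon⟩ := StochasticNS.exists_contraction hν hM0 hR hc₀ hc0 hG
  obtain ⟨A, hAdef⟩ : ∃ A, A = Real.exp (η * (ρ + 1) ^ 2 * r) := ⟨_, rfl⟩
  have hA : 0 < A := by rw [hAdef]; positivity
  obtain ⟨τ, hτ, hτ1, hτε⟩ : ∃ τ : ℝ, 0 < τ ∧ τ ≤ 1 ∧ A * (3 * τ) < ε := by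
    refine ⟨min 1 (ε / (6 * A)), by positivity, min_le_left _ _, ?_⟩
    calc A * (3 * min 1 (ε / (6 * A))) ≤ A * (3 * (ε / (6 * A))) := by
          gcongr
          exact min_le_right _ _
      _ = ε / 2 := by field_simp; norm_num
      _ < ε := half_lt_self hε
  obtain ⟨T₀, δ, hT₀, hδ, hδτ, hcon⟩ := hcon τ hτ
  refine ⟨⌈T₀ / 𝒯⌉₊, fun n hn => ?_⟩
  have hnT : T₀ ≤ n * 𝒯 := by rwa [Nat.ceil_le, div_le_iff₀ h𝒯] at hn
  obtain ⟨p, hp, hpμ⟩ := StochasticNS.exists_transition_le (ν := ν) hf hg hδ (hT₀.le.trans hnT)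
  have hp1 : min p 1 * min p 1 ≠ ∞ :=
    ENNReal.mul_ne_top (min_lt_of_right_lt ENNReal.one_lt_top).ne
      (min_lt_of_right_lt ENNReal.one_lt_top).ne
  have hp0 : 0 < min p 1 := lt_min hp one_pos
  -- `p` is cut off at `1` since `∞.toReal = 0`.
  refine ⟨(min p 1 * min p 1).toReal, ENNReal.toReal_pos (mul_ne_zero hp0.ne' hp0.ne') hp1,
    fun s w₁ w₂ hw₁ hw₂ μ₁ μ₂ hμ₁ hμ₂ => ?_⟩
  have hst : s + T₀ ≤ s + n * 𝒯 := by linarith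
  have i₁ := hμ₁.isProbabilityMeasure (by linarith)
  have i₂ := hμ₂.isProbabilityMeasure (by linarith)
  obtain ⟨Γ, hΓ₁, hΓ₂, hΓ⟩ := StochasticNS.exists_coupling_prod μ₁ μ₂
  refine ⟨Γ, ⟨hΓ₁, hΓ₂⟩, ?_⟩
  rw [ENNReal.ofReal_toReal hp1]
  have h₁ := (min_le_left p 1).trans (hpμ s w₁ μ₁ hμ₁)
  have h₂ := (min_le_left p 1).trans (hpμ s w₂ μ₂ hμ₂)
  refine (mul_le_mul' h₁ h₂).trans ?_
  rw [← hΓ]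
  -- The product set consists of pairs close to the ends of two perturbed solutions.
  refine measure_mono ?_
  rintro ⟨x₁, x₂⟩ ⟨⟨v₁, hv₁, hs₁, hx₁⟩, ⟨v₂, hv₂, hs₂, hx₂⟩⟩
  obtain ⟨b₁, b₂, b₃⟩ := hcon f hM s (s + n * 𝒯) hst v₁ v₂ hv₁ hv₂ (hs₁ ▸ hw₁) (hs₂ ▸ hw₂)
  dsimp only at hx₁ hx₂
  have hn₁ : ‖x₁‖ ≤ ρ + 1 := by
    have := norm_le_norm_add_norm_sub' x₁ (v₁ (s + n * 𝒯))
    linarith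
  have hn₂ : ‖x₂‖ ≤ ρ + 1 := by
    have := norm_le_norm_add_norm_sub' x₂ (v₂ (s + n * 𝒯))
    linarith
  have hd : ‖x₁ - x₂‖ ≤ 3 * τ := by
    have h : x₁ - x₂ = (x₁ - v₁ (s + n * 𝒯)) + (v₁ (s + n * 𝒯) - v₂ (s + n * 𝒯)) -
        (x₂ - v₂ (s + n * 𝒯)) := by abel
    rw [h]
    refine (norm_sub_le _ _).trans ?_
    have := norm_add_le (x₁ - v₁ (s + n * 𝒯)) (v₁ (s + n * 𝒯) - v₂ (s + n * 𝒯))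
    linarith
  refine (StochasticNS.weightedDist_le hη.le hr.1.le hn₁ hn₂).trans_lt ?_
  refine (ENNReal.ofReal_lt_ofReal_iff hε).mpr (lt_of_le_of_lt ?_ hτε)
  rw [← hAdef]
  gcongr
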